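/- Let $N,m,d\ge 2$ be integers and $\omega=e^{2\pi \mathrm{i}/d}$ (with $\omega^r=e^{2\pi \mathrm{i}r/d}$ for real $r$). Each of $N$ parties $i=1,\dots,N$ has a finite-dimensional Hilbert space $\mathcal H_i$ and $m$ unitary $d$-outcome observables $A_{i,1},\dots,A_{i,m}$ on it, i.e. $A_{i,x}$ is unitary with $A_{i,x}^d=\mathbb 1$; put $A_{i,x+m}=\omega A_{i,x}$. The parties share a state (density operator) $\rho$ on $\mathcal H_1\otimes\dots\otimes\mathcal H_N$. The value of the ASTA Bell expression is $$\mathcal B_{m,d,N}=\sum_{\alpha_1,\dots,\alpha_{N-1}=1}^m\ \sum_{k=1}^{d-1}\operatorname{Tr}\Big[\rho\,\big(a_kA_{1,\alpha_1}^k+a_k^*A_{1,\alpha_1+1}^k\big)\otimes\bigotimes_{i=2}^N A_{i,\alpha_{i-1}+\alpha_i-1}^{(-1)^{i-1}k}\Big],\qquad a_k=\frac{\omega^{(2k-d)/(4m)}}{2\cos(\pi/2m)},\quad \alpha_N=1 .$$ Let $F=\frac1{\sqrt d}\sum_{i,j=0}^{d-1}\omega^{ij}|i\rangle\langle j|$,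 $\Omega=\mathrm{diag}(1,\omega,\dots,\omega^{d-1})$ and $D(r)=\sum_{j=0}^{d-1}\omega^{jr}|j\rangle\langle j|$. The generalised CGLMP observables on $\mathbb C^d$ are, for $x=1,\dots,m$, $$\mathcal O_{1,x}=U_xF\Omega F^\dagger U_x^\dagger,\qquad \mathcal O_{2,x}=V_xF^\dagger\Omega FV_x^\dagger,$$ $$\mathcal O_{i,x}=W_xF\Omega F^\dagger W_x^\dagger\ \ (i\ge3\text{ odd}),\qquad \mathcal O_{i,x}=W_x^\dagger F^\dagger\Omega FW_x\ \ (i\ge 4\text{ even}),$$ where $U_x=D\big(-\tfrac{x}{m}+\tfrac1{2m}\big)$, $V_x=D\big(\tfrac xm\big)$ and $W_x=D\big(-\tfrac{x-1}m\big)$. Let $|\mathrm{GHZ}_{N,d}\rangle=\frac1{\sqrt d}\sum_{j=0}^{d-1}|j\rangle^{\otimes N}$. **Theorem 3.1.** The maximal value of $\mathcal B_{m,d,N}$ over all such states and observables is $m^{N-1}(d-1)$. Suppose that $\rho$ and $A_{i,x}$ reach this value, and that the reduced state of $\rho$ on each $\mathcal H_i$ has full rank. Then: 1. For every $i$, $\mathcal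 H_i=\mathbb C^d\otimes\mathcal H_i''$ for some finite-dimensional Hilbert space $\mathcal H_i''$. 2. There are unitaries $U_i:\mathcal H_i\to\mathcal H_i$ and a state $\rho^{\mathrm{aux}}$ on $\mathcal H_1''\otimes\dots\otimes\mathcal H_N''$ such that $$(U_1\otimes\dots\otimes U_N)\,\rho\,(U_1\otimes\dots\otimes U_N)^\dagger=|\mathrm{GHZ}_{N,d}\rangle\langle\mathrm{GHZ}_{N,d}|\otimes\rho^{\mathrm{aux}},$$ $$U_i\,A_{i,x}\,U_i^\dagger=\mathcal O_{i,x}\otimes\mathbb 1_{\mathcal H_i''}\qquad\text{for all } i=1,\dots,N,\ x=1,\dots,m .$$ -/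

import Mathlib

open scoped ComplexOrder Kronecker

noncomputable section

namespace ASTA

/-- `ω ^ r` for a real exponent `r`, where `ω = exp (2πi / d)`. -/
def omegaPow (d : ℕ) (r : ℝ) : ℂ :=
  Complex.exp (2 * Real.pi * Complex.I * r / d)

/-- The coefficient `a_k = ω ^ ((2k - d) / (4m)) / (2 cos (π / (2m)))`. -/
def aCoeff (m d k : ℕ) : ℂ :=
  omegaPow d ((2 * k - d) / (4 * m)) / ((2 * Real.cos (Real.pi / (2 * m)) : ℝ) : ℂ)

section Operators

universe u

variable {N : ℕ} {n : Fin N → Type u}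

/-- The operator `M_1 ⊗ ⋯ ⊗ M_N` on `⨂ i, ℂ^(n i)`, in the product basis indexed by `Π i, n i`. -/
def tensor (M : ∀ i, Matrix (n i) (n i) ℂ) : Matrix (∀ i, n i) (∀ i, n i) ℂ :=
  Matrix.of fun x y => ∏ i, M i (x i) (y i)

/-- The reduced state of party `i`: the partial trace of `ρ` over all the other parties. -/
def reducedState [∀ i, Fintype (n i)] [∀ i, DecidableEq (n i)]
    (ρ : Matrix (∀ i, n i) (∀ i, n i) ℂ) (i : Fin N) : Matrix (n i) (n i) ℂ :=
  Matrix.of fun a b => ∑ x : ∀ j, n j, if x i = a then ρ x (Function.update x i b) else 0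

/-- Density operators: positive semidefinite of trace one. -/
def IsState {κ : Type u} [Fintype κ] (ρ : Matrix κ κ ℂ) : Prop :=
  ρ.PosSemidef ∧ ρ.trace = 1

/-- Unitary `d`-outcome observables: unitary matrices whose eigenvalues are `d`-th roots of
unity. -/
def IsObservable (d : ℕ) {κ : Type u} [Fintype κ] [DecidableEq κ] (A : Matrix κ κ ℂ) : Prop :=
  A ∈ Matrix.unitaryGroup κ ℂ ∧ A ^ d = 1

/-- The observables `A_0, …, A_{m-1}` of one party, extended to all settings `q` by
`A_{q + m} = ω A_q`. (Settings are counted from `0`: setting `q` here is setting `q + 1` in the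
numbering `1, …, m`.) -/
def extObs {m : ℕ} (d : ℕ) {κ : Type u} (A : Fin m → Matrix κ κ ℂ) (q : ℕ) : Matrix κ κ ℂ :=
  if h : 0 < m then omegaPow d ((q / m : ℕ) : ℝ) • A ⟨q % m, Nat.mod_lt q h⟩ else 0

/-- The summation indices `α_1, …, α_{N-1}`, counted from `0` both in their position and in their
value, and continued by `0` (this is the convention `α_N = 1` of the numbering `1, …, m`). -/
def settingIndex {m : ℕ} (α : Fin (N - 1) → Fin m) (j : ℕ) : ℕ :=
  if h : j < N - 1 then (α ⟨j, h⟩ : ℕ) else 0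

/-- The tensor factor of party `i` in the term `(α, k)` of the Bell operator. Parties are counted
from `0`. The first party has `a_k A_{1,α_1}^k + a_k^* A_{1,α_1+1}^k`; a later party has
`A_{i, α_{i-1} + α_i - 1}` (numbering from `1`) to the power `k` or `-k` alternately, where
`A^{-k} = (A†)^k` as `A` is unitary. -/
def bellFactor [∀ i, Fintype (n i)] [∀ i, DecidableEq (n i)] {m : ℕ} (d : ℕ)
    (A : ∀ i, Fin m → Matrix (n i) (n i) ℂ) (α : Fin (N - 1) → Fin m) (k : ℕ) (i : Fin N) :
    Matrix (n i) (n i) ℂ :=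
  if (i : ℕ) = 0 then
    aCoeff m d k • extObs d (A i) (settingIndex α 0) ^ k
      + star (aCoeff m d k) • extObs d (A i) (settingIndex α 0 + 1) ^ k
  else if Even (i : ℕ) then
    extObs d (A i) (settingIndex α (i - 1) + settingIndex α i) ^ k
  else
    (extObs d (A i) (settingIndex α (i - 1) + settingIndex α i)).conjTranspose ^ k

/-- The Bell operator. -/
def bellOperator [∀ i, Fintype (n i)] [∀ i, DecidableEq (n i)] {m : ℕ} (d : ℕ)
    (A : ∀ i, Fin m → Matrix (n i) (n i) ℂ) : Matrix (∀ i, n i) (∀ i, n i) ℂ :=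
  ∑ α : Fin (N - 1) → Fin m, ∑ k ∈ Finset.Icc 1 (d - 1), tensor (bellFactor d A α k)

/-- The value of the Bell expression. (The trace is real, since the terms `k` and `d - k` are
adjoint to each other.) -/
def bellValue [∀ i, Fintype (n i)] [∀ i, DecidableEq (n i)] {m : ℕ} (d : ℕ)
    (A : ∀ i, Fin m → Matrix (n i) (n i) ℂ) (ρ : Matrix (∀ i, n i) (∀ i, n i) ℂ) : ℝ :=
  (bellOperator d A * ρ).trace.re

end Operators

/-- All values of the Bell expression attained by a state of `N` finite-dimensional quantum systems
and `m` unitary `d`-outcome observables per party. -/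
def quantumValues (N m d : ℕ) : Set ℝ :=
  {v | ∃ (D : Fin N → ℕ) (A : ∀ i, Fin m → Matrix (Fin (D i)) (Fin (D i)) ℂ)
      (ρ : Matrix (∀ i, Fin (D i)) (∀ i, Fin (D i)) ℂ),
      IsState ρ ∧ (∀ i x, IsObservable d (A i x)) ∧ bellValue d A ρ = v}

/-- The vector `|GHZ_{N,d}⟩ = d^{-1/2} ∑ j, |j⟩^{⊗ N}`. -/
def ghz (N d : ℕ) (x : Fin N → Fin d) : ℂ :=
  ((1 / Real.sqrt d : ℝ) : ℂ) * ∑ j : Fin d, ∏ i, if x i = j then 1 else 0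

/-- The projector `|GHZ_{N,d}⟩⟨GHZ_{N,d}|`. -/
def ghzState (N d : ℕ) : Matrix (Fin N → Fin d) (Fin N → Fin d) ℂ :=
  Matrix.vecMulVec (ghz N d) (star (ghz N d))

/-- The Fourier matrix `F_d = d^{-1/2} ∑ i j, ω^{ij} |i⟩⟨j|`. -/
def fourier (d : ℕ) : Matrix (Fin d) (Fin d) ℂ :=
  Matrix.of fun i j => ((1 / Real.sqrt d : ℝ) : ℂ) * omegaPow d ((i : ℝ) * (j : ℝ))

/-- The diagonal unitary `∑ j, ω^{j r} |j⟩⟨j|`. -/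
def phase (d : ℕ) (r : ℝ) : Matrix (Fin d) (Fin d) ℂ :=
  Matrix.diagonal fun j => omegaPow d ((j : ℝ) * r)

/-- `Ω_d = diag (1, ω, …, ω^{d-1})`. -/
def clock (d : ℕ) : Matrix (Fin d) (Fin d) ℂ :=
  phase d 1

/-- The generalised CGLMP observables `O_{i,x}`. Parties and settings are counted from `0`, so with
`X = x + 1` in the numbering `1, …, m` the three phases are `γ = X/m - 1/(2m)`, `ζ = X/m` and
`θ = (X - 1)/m`, and an even `i` is a party with an odd number in the numbering `1, …, N`. -/
def idealObs (m d : ℕ) (i x : ℕ) : Matrix (Fin d) (Fin d) ℂ :=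
  let γ : ℝ := (x + 1) / m - 1 / (2 * m)
  let ζ : ℝ := (x + 1) / m
  let θ : ℝ := x / m
  let F := fourier d
  let U := phase d (-γ)
  let V := phase d ζ
  let W := phase d (-θ)
  if i = 0 then U * F * clock d * F.conjTranspose * U.conjTranspose
  else if i = 1 then V * F.conjTranspose * clock d * F * V.conjTranspose
  else if Even i then W * F * clock d * F.conjTranspose * W.conjTranspose
  else W.conjTranspose * F.conjTranspose * clock d * F * W

end ASTA

end

/-! ### Real powers of the root of unity. -/

namespace ASTA

/-! The bound is a sum of squares. For each Bell term X, 2 Re Tr(Xρ) = 1 + ⟨X†X⟩ - ⟨(1-X)†(1-X)⟩.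
All factors of X except that of the first party are unitary, so ⟨X†X⟩ involves only C_{k,x} = a_k
A_x^k + a_k^* A_{x+1}^k. Up to scalars these are sums of neighbours in an antiperiodic sequence of
unitaries, and the discrete Wirtinger inequality (`antiperiodic_defect`) bounds their total over x
by m; this yields `bellValue_le`. The bound is attained because every ideal Bell term stabilises the
GHZ state (`tensor_bellFactor_idealObs_mul`).

At the maximum all squares vanish, so Xρ = ρ for every term, and the Wirtinger inequality is tight.
Full local rank turns equalities of local operators on ρ into equalities of operators
(`eq_of_locHom_mul_eq`). For the first party this gives C_{k,0} = C^k with C = C_{1,0} unitary and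
C^d = 1. Two unitaries with a unitary weighted combination differ by a two-valued phase on some
projection P (`exists_projection_of_unitary_combination`); comparing powers shows that the
projections C^{-j} P C^j are orthogonal and sum to 1 (`isShift_of_combination_pow`). Tightness is a
three-term recursion, which makes each A_x equal to C times a twist along P (`firstParty_of_max`).

Changing one summation index alters only two neighbouring parties, so this structure passes from
each party to the next (`exists_shift_of_max`). A pair (S, P) of this kind is unitarily the cyclic
shift and |0⟩⟨0|, tensored with an identity (`IsShift.exists_unitary`), and a twist becomes
conjugation by a diagonal phase, which gives the CGLMP observables (`lower_mul_twist`,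
`idealObs_eq`). In these coordinates ρ is invariant under the joint shift and the projections |0⟩⟨0|
of all parties agree on it, which leaves only GHZ times an auxiliary state (`eq_ghzState_mul`). -/

lemma omegaPow_zero (d : ℕ) : omegaPow d 0 = 1 := by simp [omegaPow]

lemma omegaPow_add (d : ℕ) (r s : ℝ) : omegaPow d (r + s) = omegaPow d r * omegaPow d s := by
  rw [omegaPow, omegaPow, omegaPow, ← Complex.exp_add]
  congr 1
  push_cast
  ring

lemma star_omegaPow (d : ℕ) (r : ℝ) : star (omegaPow d r) = omegaPow d (-r) := by
  simp only [omegaPow, Complex.star_def, ← Complex.exp_conj]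
  congr 1
  simp only [map_div₀, map_mul, Complex.conj_ofReal, Complex.conj_I, map_natCast,
    Complex.conj_ofNat]
  push_cast
  ring

lemma omegaPow_mul_neg (d : ℕ) (r : ℝ) : omegaPow d r * omegaPow d (-r) = 1 := by
  rw [← omegaPow_add, add_neg_cancel, omegaPow_zero]

lemma omegaPow_neg_mul (d : ℕ) (r : ℝ) : omegaPow d (-r) * omegaPow d r = 1 := by
  rw [← omegaPow_add, neg_add_cancel, omegaPow_zero]

lemma omegaPow_ne_zero (d : ℕ) (r : ℝ) : omegaPow d r ≠ 0 := Complex.exp_ne_zero _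

lemma omegaPow_pow (d : ℕ) (r : ℝ) (k : ℕ) : omegaPow d r ^ k = omegaPow d (k * r) := by
  rw [omegaPow, omegaPow, ← Complex.exp_nat_mul]
  congr 1
  push_cast
  ring

lemma norm_omegaPow (d : ℕ) (r : ℝ) : ‖omegaPow d r‖ = 1 := by
  have : (2 * Real.pi * Complex.I * r / d : ℂ) = ((2 * Real.pi * r / d : ℝ) : ℂ) * Complex.I := by
    push_cast
    ring
  rw [omegaPow, this, Complex.norm_exp_ofReal_mul_I]

lemma omegaPow_dim_mul {d : ℕ} (hd : d ≠ 0) (r : ℝ) :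
    omegaPow d (d * r) = Complex.exp ((2 * Real.pi * r : ℝ) * Complex.I) := by
  rw [omegaPow]
  congr 1
  have : (d : ℂ) ≠ 0 := by exact_mod_cast hd
  push_cast
  field_simp

lemma omegaPow_dim {d : ℕ} (hd : d ≠ 0) : omegaPow d d = 1 := by
  have := omegaPow_dim_mul hd 1
  rw [mul_one] at this
  rw [this]
  simp [Complex.exp_two_pi_mul_I]

lemma omegaPow_dim_mul_ne_one {d : ℕ} (hd : d ≠ 0) {r : ℝ} (h0 : 0 < r) (h1 : r < 1) :
    omegaPow d (d * r) ≠ 1 := by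
  rw [omegaPow_dim_mul hd]
  intro h
  obtain ⟨n, hn⟩ := Complex.exp_eq_one_iff.1 h
  have h2 : ((r : ℝ) : ℂ) = (n : ℂ) := by
    have hpi : (2 * Real.pi * Complex.I : ℂ) ≠ 0 := Complex.two_pi_I_ne_zero
    apply mul_right_cancel₀ hpi
    rw [← hn]
    push_cast
    ring
  have h3 : r = (n : ℝ) := by exact_mod_cast h2
  rw [h3] at h0 h1
  have : 0 < n := by exact_mod_cast h0
  have : n < 1 := by exact_mod_cast h1
  omega

lemma omegaPow_add_omegaPow_neg {d : ℕ} (hd : d ≠ 0) (r : ℝ) :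
    omegaPow d (d * r) + omegaPow d (-(d * r)) = ((2 * Real.cos (2 * Real.pi * r) : ℝ) : ℂ) := by
  rw [← star_omegaPow, omegaPow_dim_mul hd, Complex.star_def, Complex.add_conj,
    Complex.exp_ofReal_mul_I_re]

lemma cos_pi_div_two_mul_pos {m : ℕ} (hm : 2 ≤ m) : 0 < Real.cos (Real.pi / (2 * m)) := by
  have hm' : (2 : ℝ) ≤ m := by exact_mod_cast hm
  apply Real.cos_pos_of_mem_Ioo
  constructor
  · have : 0 < Real.pi / (2 * m) := by positivity
    linarith [Real.pi_pos]
  · apply div_lt_div_of_pos_left Real.pi_pos <;> linarith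

/-! ### The discrete Wirtinger inequality and its equality case. -/

/-- Discrete Wirtinger inequality for antiperiodic sequences, as an identity with defect. -/
lemma antiperiodic_defect {m : ℕ} (hm : 2 ≤ m) (w : ℕ → ℝ) (hw : w m = -w 0) :
    ∃ T : ℕ → ℝ, (∀ x < m, 0 ≤ T x) ∧
      (∀ x < m, T x = 0 →
        (w x - Real.cos (Real.pi / m * x) * w 0) * Real.sin (Real.pi / m * (x + 1 : ℕ)) =
        (w (x + 1) - Real.cos (Real.pi / m * (x + 1 : ℕ)) * w 0) * Real.sin (Real.pi / m * x)) ∧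
      ∑ x ∈ Finset.range m, (w x + w (x + 1)) ^ 2 + ∑ x ∈ Finset.range m, T x =
        4 * Real.cos (Real.pi / (2 * m)) ^ 2 * ∑ x ∈ Finset.range m, w x ^ 2 := by
  set θ : ℝ := Real.pi / m with hθ
  set c : ℕ → ℝ := fun x => Real.cos (θ * x) with hc
  set s : ℕ → ℝ := fun x => Real.sin (θ * x) with hs
  -- Subtracting the cosine solution with the same end values leaves a sequence that vanishes at 0
  -- and m, to be compared with the sine solution, positive in between.
  set y : ℕ → ℝ := fun x => w x - c x * w 0 with hy
  have hθm : θ * m = Real.pi := by rw [hθ]; field_simp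
  have hc2 : ∀ x, c (x + 2) = 2 * Real.cos θ * c (x + 1) - c x := by
    intro x
    have h1 : θ * ((x + 2 : ℕ) : ℝ) = θ * ((x + 1 : ℕ) : ℝ) + θ := by push_cast; ring
    have h2 : θ * (x : ℝ) = θ * ((x + 1 : ℕ) : ℝ) - θ := by push_cast; ring
    simp only [hc]
    rw [h1, h2, Real.cos_add, Real.cos_sub]
    ring
  have hs2 : ∀ x, s (x + 2) = 2 * Real.cos θ * s (x + 1) - s x := by
    intro x
    have h1 : θ * ((x + 2 : ℕ) : ℝ) = θ * ((x + 1 : ℕ) : ℝ) + θ := by push_cast; ring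
    have h2 : θ * (x : ℝ) = θ * ((x + 1 : ℕ) : ℝ) - θ := by push_cast; ring
    simp only [hs]
    rw [h1, h2, Real.sin_add, Real.sin_sub]
    ring
  have hs0 : s 0 = 0 := by simp [hs]
  have hc0 : c 0 = 1 := by simp [hc]
  have hsm : s m = 0 := by simp [hs, hθm]
  have hcm : c m = -1 := by simp [hc, hθm]
  have hc1 : c 1 = Real.cos θ := by simp [hc]
  have hcm1 : c (m + 1) = -Real.cos θ := by
    simp only [hc]
    push_cast
    rw [mul_add, hθm, mul_one, add_comm, Real.cos_add_pi]
  have hy0 : y 0 = 0 := by simp [hy, hc0]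
  have hym : y m = 0 := by simp [hy, hcm, hw]
  have hspos : ∀ x, 0 < x → x < m → 0 < s x := by
    intro x h0 h1
    have h1' : (x : ℝ) < m := by exact_mod_cast h1
    apply Real.sin_pos_of_pos_of_lt_pi
    · positivity
    · calc θ * x < θ * m := by gcongr
        _ = Real.pi := hθm
  -- Picone's substitution: at interior points `T x` becomes the square of `y x * s (x + 1) - y (x +
  -- 1) * s x` over `s x * s (x + 1)`. At 0 and m the quotient is a division by zero, harmless since
  -- `y` vanishes there.
  set h : ℕ → ℝ := fun x => s (x + 1) / s x * y x ^ 2 with hh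
  set T : ℕ → ℝ := fun x => h x - h (x + 1) + 2 * Real.cos θ * y (x + 1) ^ 2 - 2 * y x * y (x + 1)
    with hT
  have hTx : ∀ x < m, (x = 0 ∨ x = m - 1) ∧ T x = 0 ∨
      0 < s x ∧ 0 < s (x + 1) ∧ T x * (s x * s (x + 1)) =
        (y x * s (x + 1) - y (x + 1) * s x) ^ 2 := by
    intro x hx
    rcases Nat.eq_zero_or_pos x with rfl | hx0
    · left
      refine ⟨Or.inl rfl, ?_⟩
      have h1 := hs2 0
      have h1' := hspos 1 one_pos (by omega)
      simp only [hT, hh, hy0, zero_add] at h1 ⊢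
      rw [h1, hs0]
      field_simp
      ring
    · by_cases hx1 : x + 1 < m
      · right
        have p0 := hspos x hx0 hx
        have p1 := hspos (x + 1) (by omega) hx1
        refine ⟨p0, p1, ?_⟩
        simp only [hT, hh]
        rw [hs2 x]
        field_simp
        ring
      · left
        have hxm : x + 1 = m := by omega
        refine ⟨Or.inr (by omega), ?_⟩
        simp only [hT, hh]
        rw [hxm, hym, hsm]
        ring
  refine ⟨T, ?_, ?_, ?_⟩
  · intro x hx
    rcases hTx x hx with ⟨-, h0⟩ | ⟨p0, p1, h0⟩
    · exact h0.ge
    · have : 0 ≤ T x * (s x * s (x + 1)) := h0 ▸ sq_nonneg _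
      exact nonneg_of_mul_nonneg_left this (mul_pos p0 p1)
  · intro x hx hx0
    change y x * s (x + 1) = y (x + 1) * s x
    rcases hTx x hx with ⟨h1 | h1, -⟩ | ⟨-, -, h0⟩
    · rw [h1, hy0, hs0]; ring
    · rw [show x + 1 = m by omega, hym, hsm]; ring
    · rw [hx0, zero_mul] at h0
      exact sub_eq_zero.1 (pow_eq_zero_iff two_ne_zero |>.1 h0.symm)
  -- A telescoping potential; antiperiodicity makes its values at 0 and m equal.
  · set G : ℕ → ℝ := fun x => w x ^ 2 + h x + w 0 * (2 * y x * c (x + 1)) +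
        w 0 ^ 2 * (c x * c (x + 1)) - (2 + 2 * Real.cos θ) * w x ^ 2 with hG
    have key : ∀ x, (w x + w (x + 1)) ^ 2 + T x - (2 + 2 * Real.cos θ) * w x ^ 2 =
        G x - G (x + 1) := by
      intro x
      simp only [hG, add_assoc, Nat.reduceAdd, hc2 x]
      simp only [hT, hy]
      ring
    have hsum : ∑ x ∈ Finset.range m,
        ((w x + w (x + 1)) ^ 2 + T x - (2 + 2 * Real.cos θ) * w x ^ 2) = G 0 - G m := by
      rw [Finset.sum_congr rfl fun x _ => key x, Finset.sum_range_sub']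
    have hG0m : G 0 = G m := by
      simp only [hG, hh, hy0, hym, hw, hc0, hc1, hcm, hcm1]
      simp only [zero_add]
      ring
    rw [hG0m, sub_self, Finset.sum_sub_distrib, Finset.sum_add_distrib, ← Finset.mul_sum,
      sub_eq_zero] at hsum
    rw [hsum]
    congr 1
    have : θ = 2 * (Real.pi / (2 * m)) := by rw [hθ]; field_simp
    rw [this, Real.cos_two_mul]
    ring

lemma antiperiodic_sum_sq_le {m : ℕ} (hm : 2 ≤ m) (w : ℕ → ℝ) (hw : w m = -w 0) :
    ∑ x ∈ Finset.range m, (w x + w (x + 1)) ^ 2 ≤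
      4 * Real.cos (Real.pi / (2 * m)) ^ 2 * ∑ x ∈ Finset.range m, w x ^ 2 := by
  obtain ⟨T, hT, -, h⟩ := antiperiodic_defect hm w hw
  have := Finset.sum_nonneg fun x hx => hT x (Finset.mem_range.1 hx)
  linarith

/-- Zero defect makes `w` minus its cosine part proportional to the sine at neighbouring points, so
`w` obeys the recursion of both. The sine at the middle point is positive and can be cancelled. -/
lemma antiperiodic_recursion_of_eq {m : ℕ} (hm : 2 ≤ m) (w : ℕ → ℝ) (hw : w m = -w 0)
    (heq : ∑ x ∈ Finset.range m, (w x + w (x + 1)) ^ 2 =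
      4 * Real.cos (Real.pi / (2 * m)) ^ 2 * ∑ x ∈ Finset.range m, w x ^ 2)
    {x : ℕ} (hx : x + 2 ≤ m) :
    w (x + 2) = 2 * Real.cos (Real.pi / m) * w (x + 1) - w x := by
  obtain ⟨T, hT, hT', h⟩ := antiperiodic_defect hm w hw
  have hsum : ∑ x ∈ Finset.range m, T x = 0 := by linarith
  have hT0 : ∀ x < m, T x = 0 := fun x hx =>
    (Finset.sum_eq_zero_iff_of_nonneg fun x hx => hT x (Finset.mem_range.1 hx)).1 hsum x
      (Finset.mem_range.2 hx)
  have e0 := hT' x (by omega) (hT0 x (by omega))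
  have e1 := hT' (x + 1) (by omega) (hT0 (x + 1) (by omega))
  set θ : ℝ := Real.pi / m with hθ
  have hpos : 0 < Real.sin (θ * (x + 1 : ℕ)) := by
    apply Real.sin_pos_of_pos_of_lt_pi
    · positivity
    · have : ((x + 1 : ℕ) : ℝ) < m := by exact_mod_cast (by omega : x + 1 < m)
      calc θ * (x + 1 : ℕ) < θ * m := by gcongr
        _ = Real.pi := by rw [hθ]; field_simp
  have h1 : θ * ((x + 1 + 1 : ℕ) : ℝ) = θ * ((x + 1 : ℕ) : ℝ) + θ := by push_cast; ring
  have h2 : θ * (x : ℝ) = θ * ((x + 1 : ℕ) : ℝ) - θ := by push_cast; ring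
  rw [h1, Real.sin_add, Real.cos_add] at e1
  rw [h2, Real.sin_sub, Real.cos_sub] at e0
  apply mul_left_cancel₀ hpos.ne'
  linear_combination -e1 + e0

lemma antiperiodic_normSq {m : ℕ} (hm : 2 ≤ m) (w : ℕ → ℂ) (hw : w m = -w 0) :
    ∑ x ∈ Finset.range m, Complex.normSq (w x + w (x + 1)) ≤
        4 * Real.cos (Real.pi / (2 * m)) ^ 2 * ∑ x ∈ Finset.range m, Complex.normSq (w x) ∧
    (∑ x ∈ Finset.range m, Complex.normSq (w x + w (x + 1)) =
        4 * Real.cos (Real.pi / (2 * m)) ^ 2 * ∑ x ∈ Finset.range m, Complex.normSq (w x) →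
      ∀ x, x + 2 ≤ m → w (x + 2) = (2 * Real.cos (Real.pi / m) : ℝ) * w (x + 1) - w x) := by
  have hre : (w m).re = -(w 0).re := by simp [hw]
  have him : (w m).im = -(w 0).im := by simp [hw]
  have h1 := antiperiodic_sum_sq_le hm (fun x => (w x).re) hre
  have h2 := antiperiodic_sum_sq_le hm (fun x => (w x).im) him
  have e1 : ∑ x ∈ Finset.range m, Complex.normSq (w x + w (x + 1)) =
      ∑ x ∈ Finset.range m, ((w x).re + (w (x + 1)).re) ^ 2 +
      ∑ x ∈ Finset.range m, ((w x).im + (w (x + 1)).im) ^ 2 := by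
    rw [← Finset.sum_add_distrib]
    refine Finset.sum_congr rfl fun x _ => ?_
    rw [Complex.normSq_apply, Complex.add_re, Complex.add_im]
    ring
  have e2 : ∑ x ∈ Finset.range m, Complex.normSq (w x) =
      ∑ x ∈ Finset.range m, (w x).re ^ 2 + ∑ x ∈ Finset.range m, (w x).im ^ 2 := by
    rw [← Finset.sum_add_distrib]
    refine Finset.sum_congr rfl fun x _ => ?_
    rw [Complex.normSq_apply]
    ring
  rw [e1, e2, mul_add]
  refine ⟨add_le_add h1 h2, fun heq x hx => ?_⟩
  have r1 := antiperiodic_recursion_of_eq hm (fun x => (w x).re) hre (by linarith) hx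
  have r2 := antiperiodic_recursion_of_eq hm (fun x => (w x).im) him (by linarith) hx
  apply Complex.ext
  · rw [Complex.sub_re, Complex.re_ofReal_mul]
    exact r1
  · rw [Complex.sub_im, Complex.im_ofReal_mul]
    exact r2

end ASTA

namespace ASTA
open Matrix

/-! ### Tensor products, local operators and reduced states. -/

section TensorAlgebra

set_option linter.unusedSectionVars false

universe u

variable {N : ℕ} {n : Fin N → Type u}

lemma tensor_apply (M : ∀ i, Matrix (n i) (n i) ℂ) (x y : ∀ i, n i) :
    tensor M x y = ∏ i, M i (x i) (y i) := rfl

lemma conjTranspose_tensor (M : ∀ i, Matrix (n i) (n i) ℂ) :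
    (tensor M)ᴴ = tensor fun i => (M i)ᴴ := by
  ext x y
  simp [tensor_apply, Matrix.conjTranspose_apply]

variable [∀ i, Fintype (n i)] [∀ i, DecidableEq (n i)]

lemma tensor_mul (M M' : ∀ i, Matrix (n i) (n i) ℂ) :
    tensor M * tensor M' = tensor fun i => M i * M' i := by
  ext x y
  simp only [tensor_apply, Matrix.mul_apply, ← Finset.prod_mul_distrib]
  rw [Finset.prod_univ_sum, Fintype.piFinset_univ]

lemma tensor_one : tensor (fun i => (1 : Matrix (n i) (n i) ℂ)) = 1 := by
  ext x y
  simp only [tensor_apply, Matrix.one_apply]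
  rw [Finset.prod_ite_zero]
  simp [funext_iff]

lemma tensor_pow (M : ∀ i, Matrix (n i) (n i) ℂ) (k : ℕ) :
    tensor M ^ k = tensor fun i => M i ^ k := by
  induction k with
  | zero => simp [tensor_one]
  | succ k ih => simp only [pow_succ, ih, tensor_mul]

/-- The operator `X` of party `i`, extended by the identity. -/
def loc (i : Fin N) (X : Matrix (n i) (n i) ℂ) : Matrix (∀ i, n i) (∀ i, n i) ℂ :=
  tensor (Function.update (fun _ => 1) i X)

lemma loc_apply (i : Fin N) (X : Matrix (n i) (n i) ℂ) (x y : ∀ i, n i) :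
    loc i X x y = if y = Function.update x i (y i) then X (x i) (y i) else 0 := by
  rw [loc, tensor_apply, ← Finset.mul_prod_erase _ _ (Finset.mem_univ i), Function.update_self]
  have : ∏ j ∈ Finset.univ.erase i, Function.update (fun j => (1 : Matrix (n j) (n j) ℂ)) i X j
      (x j) (y j) = if y = Function.update x i (y i) then 1 else 0 := by
    rw [Finset.prod_congr rfl (g := fun j => if x j = y j then (1 : ℂ) else 0)]
    · rw [Finset.prod_ite_zero]
      simp only [Finset.prod_const_one]
      congr 1
      rw [eq_iff_iff, Function.eq_update_iff]
      constructor
      · intro h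
        exact ⟨rfl, fun j hj => (h j (Finset.mem_erase.2 ⟨hj, Finset.mem_univ _⟩)).symm⟩
      · rintro ⟨-, h⟩ j hj
        exact (h j (Finset.ne_of_mem_erase hj)).symm
    · intro j hj
      rw [Function.update_of_ne (Finset.ne_of_mem_erase hj), Matrix.one_apply]
  rw [this]
  split_ifs <;> simp

lemma loc_mul_loc (i : Fin N) (X Y : Matrix (n i) (n i) ℂ) :
    loc i X * loc i Y = loc i (X * Y) := by
  rw [loc, loc, loc, tensor_mul]
  congr 1
  ext1 j
  by_cases h : j = i
  · subst h; simp
  · simp [h]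

lemma loc_one (i : Fin N) : loc i (1 : Matrix (n i) (n i) ℂ) = 1 := by
  rw [loc, Function.update_eq_self_iff.2 rfl, tensor_one]

lemma loc_add (i : Fin N) (X Y : Matrix (n i) (n i) ℂ) : loc i (X + Y) = loc i X + loc i Y := by
  ext x y
  simp only [Matrix.add_apply, loc_apply]
  split_ifs <;> simp

lemma loc_smul (i : Fin N) (c : ℂ) (X : Matrix (n i) (n i) ℂ) : loc i (c • X) = c • loc i X := by
  ext x y
  simp only [Matrix.smul_apply, loc_apply]
  split_ifs <;> simp

variable (n) in
/-- The embedding of the operators of party `i` into the global operators. -/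
def locHom (i : Fin N) : Matrix (n i) (n i) ℂ →⋆ₐ[ℂ] Matrix (∀ i, n i) (∀ i, n i) ℂ where
  toFun := loc i
  map_one' := loc_one i
  map_mul' X Y := (loc_mul_loc i X Y).symm
  map_zero' := by simpa using loc_smul i 0 (0 : Matrix (n i) (n i) ℂ)
  map_add' := loc_add i
  commutes' c := by
    rw [Algebra.algebraMap_eq_smul_one, Algebra.algebraMap_eq_smul_one, loc_smul, loc_one]
  map_star' X := by
    rw [Matrix.star_eq_conjTranspose, Matrix.star_eq_conjTranspose, loc, loc, conjTranspose_tensor]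
    congr 1
    ext1 j
    by_cases h : j = i
    · subst h; simp
    · simp [h]

lemma locHom_apply (i : Fin N) (X : Matrix (n i) (n i) ℂ) :
    locHom n i X = tensor (Function.update (fun _ => 1) i X) := rfl

lemma locHom_mul_locHom {i j : Fin N} (hij : i ≠ j) (X : Matrix (n i) (n i) ℂ)
    (Y : Matrix (n j) (n j) ℂ) :
    locHom n i X * locHom n j Y =
      tensor (Function.update (Function.update (fun _ => 1) i X) j Y) := by
  rw [locHom_apply, locHom_apply, tensor_mul]
  congr 1
  ext1 k
  by_cases hk : k = j
  · subst hk; simp [hij.symm]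
  · by_cases hk' : k = i
    · subst hk'; simp [hij]
    · simp [hk, hk']

lemma locHom_commute {i j : Fin N} (hij : i ≠ j) (X : Matrix (n i) (n i) ℂ)
    (Y : Matrix (n j) (n j) ℂ) : locHom n i X * locHom n j Y = locHom n j Y * locHom n i X := by
  rw [locHom_mul_locHom hij, locHom_mul_locHom hij.symm, Function.update_comm hij]

/-- The partial trace runs over the other tensor legs, so an operator on leg i can be pulled out of
it. An invertible reduced state then allows cancelling ρ. -/
lemma reducedState_locHom_mul (ρ : Matrix (∀ i, n i) (∀ i, n i) ℂ) (i : Fin N)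
    (X : Matrix (n i) (n i) ℂ) :
    reducedState (locHom n i X * ρ) i = X * reducedState ρ i := by
  ext a b
  have h1 : ∀ x y, (locHom n i X * ρ) x y =
      ∑ c, X (x i) c * ρ (Function.update x i c) y := by
    intro x y
    rw [Matrix.mul_apply]
    simp only [show ∀ z, locHom n i X x z = loc i X x z from fun _ => rfl, loc_apply, ite_mul,
      zero_mul]
    rw [← Finset.sum_filter]
    refine Finset.sum_nbij' (fun z => z i) (fun c => Function.update x i c) ?_ ?_ ?_ ?_ ?_
    · simp
    · simp
    · intro z hz
      exact (Finset.mem_filter.1 hz).2.symm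
    · simp
    · intro z hz
      rw [← (Finset.mem_filter.1 hz).2]
  simp only [reducedState, Matrix.of_apply, Matrix.mul_apply, h1, ← Finset.sum_filter,
    Finset.mul_sum (s := Finset.filter _ _)]
  rw [Finset.sum_comm]
  refine Finset.sum_congr rfl fun c _ => ?_
  refine Finset.sum_nbij' (fun x => Function.update x i c) (fun x => Function.update x i a)
    ?_ ?_ ?_ ?_ ?_
  · simp
  · simp
  · intro x hx
    simp [← (Finset.mem_filter.1 hx).2]
  · intro x hx
    simp [← (Finset.mem_filter.1 hx).2]
  · intro x hx
    simp [(Finset.mem_filter.1 hx).2]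

/-- A full-rank reduced state separates the local operators. -/
lemma eq_of_locHom_mul_eq {ρ : Matrix (∀ i, n i) (∀ i, n i) ℂ} {i : Fin N}
    (hρ : (reducedState ρ i).rank = Fintype.card (n i)) {X Y : Matrix (n i) (n i) ℂ}
    (h : locHom n i X * ρ = locHom n i Y * ρ) : X = Y := by
  have h1 : X * reducedState ρ i = Y * reducedState ρ i := by
    rw [← reducedState_locHom_mul, ← reducedState_locHom_mul, h]
  have h2 : IsUnit (reducedState ρ i) := by
    rw [← Matrix.linearIndependent_rows_iff_isUnit]
    rw [Matrix.rank_eq_finrank_span_row] at hρ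
    rw [linearIndependent_iff_card_eq_finrank_span, Set.finrank, hρ]
  exact h2.mul_right_cancel h1

end TensorAlgebra

end ASTA

namespace ASTA
open Matrix

/-! ### Expectations of squares in a state. -/

section QuadraticForm

set_option linter.unusedSectionVars false

variable {κ : Type*} [Fintype κ] [DecidableEq κ]

open scoped MatrixOrder in
lemma exists_eq_mul_conjTranspose {ρ : Matrix κ κ ℂ} (hρ : ρ.PosSemidef) :
    ∃ R : Matrix κ κ ℂ, ρ = R * Rᴴ := by
  obtain ⟨S, hS⟩ := CStarAlgebra.nonneg_iff_eq_star_mul_self.1 (Matrix.nonneg_iff_posSemidef.2 hρ)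
  exact ⟨star S, by rw [hS, ← star_eq_conjTranspose, star_star]⟩

/-- The expectation of `Mᴴ * M` in the state `ρ`. -/
def sqExp (ρ M : Matrix κ κ ℂ) : ℝ := (Mᴴ * M * ρ).trace.re

/-- By cyclicity of the trace the expectation is a squared Frobenius norm, so inequalities for
scalar sequences apply entry by entry. -/
lemma sqExp_mul_conjTranspose (R M : Matrix κ κ ℂ) :
    sqExp (R * Rᴴ) M = ∑ a, ∑ b, Complex.normSq ((M * R) a b) := by
  have : (Mᴴ * M * (R * Rᴴ)).trace = ((M * R)ᴴ * (M * R)).trace := by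
    rw [conjTranspose_mul, ← Matrix.mul_assoc, Matrix.trace_mul_comm]
    simp only [Matrix.mul_assoc]
  rw [sqExp, this, Matrix.trace, Complex.re_sum, Finset.sum_comm]
  refine Finset.sum_congr rfl fun b _ => ?_
  rw [diag_apply, Matrix.mul_apply, Complex.re_sum]
  refine Finset.sum_congr rfl fun a _ => ?_
  rw [conjTranspose_apply, Complex.star_def, ← Complex.normSq_eq_conj_mul_self, Complex.ofReal_re]

lemma sqExp_nonneg {ρ : Matrix κ κ ℂ} (hρ : ρ.PosSemidef) (M : Matrix κ κ ℂ) : 0 ≤ sqExp ρ M := by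
  obtain ⟨R, rfl⟩ := exists_eq_mul_conjTranspose hρ
  rw [sqExp_mul_conjTranspose]
  exact Finset.sum_nonneg fun a _ => Finset.sum_nonneg fun b _ => Complex.normSq_nonneg _

lemma mul_eq_zero_of_sqExp_eq_zero {ρ : Matrix κ κ ℂ} (hρ : ρ.PosSemidef) {M : Matrix κ κ ℂ}
    (h : sqExp ρ M = 0) : M * ρ = 0 := by
  obtain ⟨R, rfl⟩ := exists_eq_mul_conjTranspose hρ
  rw [sqExp_mul_conjTranspose] at h
  have : M * R = 0 := by
    ext a b
    have h1 := (Finset.sum_eq_zero_iff_of_nonneg fun a _ =>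
      Finset.sum_nonneg fun b _ => Complex.normSq_nonneg _).1 h a (Finset.mem_univ _)
    have h2 := (Finset.sum_eq_zero_iff_of_nonneg fun b _ => Complex.normSq_nonneg _).1 h1 b
      (Finset.mem_univ _)
    exact Complex.normSq_eq_zero.1 h2
  rw [← Matrix.mul_assoc, this, Matrix.zero_mul]

lemma sqExp_unitary_mul {ρ V M : Matrix κ κ ℂ} (hV : Vᴴ * V = 1) :
    sqExp ρ (V * M) = sqExp ρ M := by
  rw [sqExp, sqExp, conjTranspose_mul, Matrix.mul_assoc Mᴴ, ← Matrix.mul_assoc Vᴴ, hV,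
    Matrix.one_mul]

lemma sqExp_smul (ρ M : Matrix κ κ ℂ) (c : ℂ) :
    sqExp ρ (c • M) = Complex.normSq c * sqExp ρ M := by
  rw [sqExp, sqExp, conjTranspose_smul, Matrix.smul_mul, Matrix.mul_smul, smul_smul,
    Matrix.smul_mul, Matrix.trace_smul, smul_eq_mul, Complex.star_def,
    ← Complex.normSq_eq_conj_mul_self, Complex.re_ofReal_mul]

lemma sqExp_of_isometry {ρ V : Matrix κ κ ℂ} (hρ : IsState ρ) (hV : Vᴴ * V = 1) :
    sqExp ρ V = 1 := by
  rw [sqExp, hV, Matrix.one_mul, hρ.2, Complex.one_re]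

/-- Expand the square of `1 - X`; the two cross terms have conjugate traces. Applied to every Bell
term, this is the source of the sum of squares. -/
lemma two_mul_re_trace_mul {ρ : Matrix κ κ ℂ} (hρ : IsState ρ) (X : Matrix κ κ ℂ) :
    2 * (X * ρ).trace.re = 1 + sqExp ρ X - sqExp ρ (1 - X) := by
  have h1 : (Xᴴ * ρ).trace.re = (X * ρ).trace.re := by
    have : (Xᴴ * ρ).trace = star (X * ρ).trace := by
      rw [← trace_conjTranspose, conjTranspose_mul, hρ.1.1, Matrix.trace_mul_comm]
    rw [this, Complex.star_def, Complex.conj_re]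
  have h2 : (1 - X)ᴴ * (1 - X) * ρ = ρ - X * ρ - Xᴴ * ρ + Xᴴ * X * ρ := by
    rw [conjTranspose_sub, conjTranspose_one]
    noncomm_ring
  rw [sqExp, sqExp, h2, trace_add, trace_sub, trace_sub, hρ.2, Complex.add_re, Complex.sub_re,
    Complex.sub_re, h1, Complex.one_re]
  ring

/-- The scalar inequality is used for each entry of `V x * R`, where ρ = R Rᴴ; the factor m is the
total expectation of m isometries. A tight sum is tight in every entry, which returns the recursion
as an operator identity on ρ. -/
lemma sum_sqExp_antiperiodic {ρ : Matrix κ κ ℂ} (hρ : IsState ρ) {m : ℕ} (hm : 2 ≤ m)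
    (V : ℕ → Matrix κ κ ℂ) (hV : ∀ x, (V x)ᴴ * V x = 1) (hVm : V m = -V 0) :
    ∑ x ∈ Finset.range m, sqExp ρ (V x + V (x + 1)) ≤
        4 * Real.cos (Real.pi / (2 * m)) ^ 2 * m ∧
    (∑ x ∈ Finset.range m, sqExp ρ (V x + V (x + 1)) =
        4 * Real.cos (Real.pi / (2 * m)) ^ 2 * m →
      ∀ x, x + 2 ≤ m →
        V (x + 2) * ρ = (((2 * Real.cos (Real.pi / m) : ℝ) : ℂ) • V (x + 1) - V x) * ρ) := by
  have hsum : 4 * Real.cos (Real.pi / (2 * m)) ^ 2 * m =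
      4 * Real.cos (Real.pi / (2 * m)) ^ 2 * ∑ x ∈ Finset.range m, sqExp ρ (V x) := by
    simp [sqExp_of_isometry hρ (hV _)]
  rw [hsum]
  obtain ⟨R, rfl⟩ := exists_eq_mul_conjTranspose hρ.1
  have key := fun a b => antiperiodic_normSq hm (fun x => (V x * R) a b) (by simp [hVm])
  have e1 : ∀ W : ℕ → Matrix κ κ ℂ, ∑ x ∈ Finset.range m, sqExp (R * Rᴴ) (W x) =
      ∑ p : κ × κ, ∑ x ∈ Finset.range m, Complex.normSq ((W x * R) p.1 p.2) := by
    intro W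
    rw [Finset.sum_comm]
    refine Finset.sum_congr rfl fun x _ => ?_
    rw [sqExp_mul_conjTranspose, Fintype.sum_prod_type]
  rw [e1, e1, Finset.mul_sum]
  simp only [Matrix.add_mul, Matrix.add_apply]
  have hle := fun (p : κ × κ) (_ : p ∈ Finset.univ) => (key p.1 p.2).1
  refine ⟨Finset.sum_le_sum hle, fun heq x hx => ?_⟩
  rw [Finset.sum_eq_sum_iff_of_le hle] at heq
  rw [← Matrix.mul_assoc, ← Matrix.mul_assoc]
  congr 1
  ext a b
  rw [(key a b).2 (heq (a, b) (Finset.mem_univ _)) x hx]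
  simp [Matrix.sub_mul]

end QuadraticForm

end ASTA

namespace ASTA

/-! ### Twists and cyclic families of projections. -/

section Shift

set_option linter.unusedSectionVars false

variable {R : Type*} [Ring R] [Algebra ℂ R]

/-- `ω ^ r` on the kernel of `P` and `ω ^ (r - d r)` on its range. -/
noncomputable def twist (d : ℕ) (r : ℝ) (P : R) : R :=
  omegaPow d r • (1 - P) + omegaPow d (r - d * r) • P

lemma smul_compl_add_smul_mul {P : R} (hP : P * P = P) (a b a' b' : ℂ) :
    (a • (1 - P) + b • P) * (a' • (1 - P) + b' • P) = (a * a') • (1 - P) + (b * b') • P := by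
  simp only [mul_add, add_mul, mul_sub, sub_mul, smul_mul_assoc, mul_smul_comm, hP, one_mul,
    mul_one]
  module

lemma twist_mul_twist (d : ℕ) (r s : ℝ) {P : R} (hP : P * P = P) :
    twist d r P * twist d s P = twist d (r + s) P := by
  rw [twist, twist, smul_compl_add_smul_mul hP, ← omegaPow_add, ← omegaPow_add, twist]
  congr 3
  ring

lemma twist_zero (d : ℕ) (P : R) : twist d 0 P = 1 := by
  simp [twist, omegaPow_zero]

lemma twist_mul_neg (d : ℕ) (r : ℝ) {P : R} (hP : P * P = P) :
    twist d r P * twist d (-r) P = 1 := by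
  rw [twist_mul_twist d _ _ hP, add_neg_cancel, twist_zero]

lemma twist_neg_mul (d : ℕ) (r : ℝ) {P : R} (hP : P * P = P) :
    twist d (-r) P * twist d r P = 1 := by
  rw [twist_mul_twist d _ _ hP, neg_add_cancel, twist_zero]

lemma twist_eq (d : ℕ) (r : ℝ) (P : R) :
    twist d r P = omegaPow d r • (1 - (1 - omegaPow d (-(d * r))) • P) := by
  rw [twist, sub_eq_add_neg r, omegaPow_add]
  module

variable [StarRing R] [StarModule ℂ R]

lemma star_twist (d : ℕ) (r : ℝ) {P : R} (hP : star P = P) :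
    star (twist d r P) = twist d (-r) P := by
  rw [twist, star_add, star_smul, star_smul, star_sub, star_one, hP, star_omegaPow, star_omegaPow,
    twist]
  congr 3
  ring

/-- The projection `P` conjugated by the `j`-th power of `S`. -/
def shiftProj (S P : R) (j : ℕ) : R := star S ^ j * P * S ^ j

/-- A unitary `S` with `S ^ d = 1` that permutes cyclically the `d` pairwise orthogonal projections
`S⁻ʲ P Sʲ`, whose sum is the identity. -/
structure IsShift (d : ℕ) (S P : R) : Prop where
  star_mul_self : star S * S = 1
  mul_star_self : S * star S = 1
  pow_eq_one : S ^ d = 1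
  proj : IsStarProjection P
  orthogonal : ∀ j < d, ∀ k < d, j ≠ k → shiftProj S P j * shiftProj S P k = 0
  sum_eq_one : ∑ j ∈ Finset.range d, shiftProj S P j = 1

lemma star_pow_mul_pow {S : R} (hS : star S * S = 1) (j : ℕ) : star S ^ j * S ^ j = 1 := by
  induction j with
  | zero => simp
  | succ j ih =>
    rw [pow_succ, pow_succ', mul_assoc, ← mul_assoc (star S), hS, one_mul, ih]

lemma pow_mul_star_pow {S : R} (hS : S * star S = 1) (j : ℕ) : S ^ j * star S ^ j = 1 := by
  simpa using star_pow_mul_pow (S := star S) (by simpa using hS) j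

lemma star_shiftProj {S P : R} (hP : IsStarProjection P) (j : ℕ) :
    star (shiftProj S P j) = shiftProj S P j := by
  simp only [shiftProj, star_mul, star_pow, star_star, hP.isSelfAdjoint.star_eq, mul_assoc]

lemma shiftProj_mul_self {S P : R} (hS : S * star S = 1) (hP : IsStarProjection P) (j : ℕ) :
    shiftProj S P j * shiftProj S P j = shiftProj S P j := by
  have h : shiftProj S P j * shiftProj S P j =
      star S ^ j * P * (S ^ j * star S ^ j) * P * S ^ j := by
    simp only [shiftProj, mul_assoc]
  rw [h, pow_mul_star_pow hS, mul_one, mul_assoc (star S ^ j), hP.isIdempotentElem.eq, shiftProj]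

/-- If the powers of `A (1 - z P)` have the form `A ^ k (1 - z P_k)` for two different values
of `z`, then `P` and `A` form a shift. -/
lemma isShift_of_pow_eq {d : ℕ} {A P : R} (hA : star A * A = 1) (hA' : A * star A = 1)
    (hAd : A ^ d = 1) (hP : IsStarProjection P) {s t : ℂ} (hst : s ≠ t) (hs0 : s ≠ 0) (ht0 : t ≠ 0)
    (ht1 : t ≠ 1) (p : ℕ → R)
    (ht : ∀ k < d, (A * (1 - t • P)) ^ k = A ^ k * (1 - t • p k))
    (hs : ∀ k < d, (A * (1 - s • P)) ^ k = A ^ k * (1 - s • p k))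
    (htd : (A * (1 - t • P)) ^ d = (1 - t) • (1 : R)) (hd : 0 < d) :
    IsShift d A P ∧ ∀ k < d, shiftProj A P k * p k = 0 := by
  -- Moving the new factor past `A ^ k` replaces `P` by its conjugate `shiftProj A P k`.
  have hsucc : ∀ (z : ℂ) (k : ℕ), (A * (1 - z • P)) ^ k = A ^ k * (1 - z • p k) →
      (A * (1 - z • P)) ^ (k + 1) =
        A ^ (k + 1) * ((1 - z • shiftProj A P k) * (1 - z • p k)) := by
    intro z k h
    have h1 : (1 - z • P) * A ^ k = A ^ k * (1 - z • shiftProj A P k) := by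
      have h2 : A ^ k * shiftProj A P k = P * A ^ k := by
        rw [shiftProj, mul_assoc, ← mul_assoc, pow_mul_star_pow hA', one_mul]
      rw [mul_sub, sub_mul, mul_one, one_mul, mul_smul_comm, h2, smul_mul_assoc]
    rw [pow_succ', h, mul_assoc, ← mul_assoc (1 - z • P), h1, pow_succ']
    simp only [mul_assoc]
  have hcancel : ∀ (k : ℕ) (X Y : R), A ^ k * X = A ^ k * Y → X = Y := by
    intro k X Y h
    have := congrArg (star A ^ k * ·) h
    simpa [← mul_assoc, star_pow_mul_pow hA] using this
  have expand : ∀ (z : ℂ) (X Y : R),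
      (1 - z • X) * (1 - z • Y) = 1 - z • (X + Y - z • (X * Y)) := by
    intro z X Y
    simp only [mul_sub, sub_mul, smul_mul_assoc, mul_smul_comm, one_mul, mul_one]
    module
  -- With Q = `shiftProj A P k`, both values of z give `p (k + 1)` = Q + `p k` - z Q `p k`. Since
  -- they differ, the product Q `p k` is zero.
  have hstep : ∀ k, k + 1 < d → shiftProj A P k * p k = 0 ∧
      p (k + 1) = p k + shiftProj A P k := by
    intro k hk
    have ez : ∀ z : ℂ, z ≠ 0 → (∀ k < d, (A * (1 - z • P)) ^ k = A ^ k * (1 - z • p k)) →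
        p (k + 1) = shiftProj A P k + p k - z • (shiftProj A P k * p k) := by
      intro z hz h
      have h1 := hcancel _ _ _ ((h (k + 1) hk).symm.trans (hsucc z k (h k (by omega))))
      rw [expand, sub_right_inj] at h1
      exact smul_right_injective R hz h1
    have e1 := ez s hs0 hs
    have e2 := ez t ht0 ht
    have e3 : (t - s) • (shiftProj A P k * p k) = 0 := by
      rw [sub_smul, sub_eq_zero]
      have := e1.symm.trans e2
      rwa [sub_right_inj, eq_comm] at this
    have e4 := (smul_eq_zero.1 e3).resolve_left (sub_ne_zero.2 hst.symm)
    refine ⟨e4, ?_⟩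
    rw [e1, e4, smul_zero, sub_zero, add_comm]
  have hp0 : p 0 = 0 := by
    have := ht 0 hd
    simp only [pow_zero, one_mul] at this
    rw [eq_comm, sub_eq_self] at this
    exact (smul_eq_zero.1 this).resolve_left ht0
  -- The form of the d-th power is given only for t. Multiplying by the idempotent `shiftProj A P k`
  -- produces a common factor 1 - t, nonzero by `ht1`.
  have hlast : ∀ k, k + 1 = d → shiftProj A P k * p k = 0 ∧ p k + shiftProj A P k = 1 := by
    intro k hk
    have h1 := hsucc t k (ht k (by omega))
    rw [hk, htd, hAd, one_mul] at h1
    have hQ := shiftProj_mul_self hA' hP k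
    have h2 := congrArg (shiftProj A P k * ·) h1
    have h3 : t • (shiftProj A P k * p k) = 0 := by
      have h4 : (1 - t) • (t • (shiftProj A P k * p k)) = 0 := by
        simp only [mul_sub, sub_mul, smul_mul_assoc, mul_smul_comm, one_mul, mul_one,
          ← mul_assoc, hQ] at h2
        rw [← sub_eq_zero] at h2
        rw [← h2]
        module
      exact (smul_eq_zero.1 h4).resolve_left (sub_ne_zero.2 ht1.symm)
    have h5 := (smul_eq_zero.1 h3).resolve_left ht0
    refine ⟨h5, ?_⟩
    rw [expand, h5, smul_zero, sub_zero, sub_smul, one_smul, sub_right_inj] at h1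
    rw [add_comm]
    exact (smul_right_injective R ht0 h1).symm
  have hmul : ∀ k < d, shiftProj A P k * p k = 0 := by
    intro k hk
    rcases Nat.lt_or_ge (k + 1) d with h | h
    · exact (hstep k h).1
    · exact (hlast k (by omega)).1
  have hp : ∀ k < d, p k = ∑ j ∈ Finset.range k, shiftProj A P j := by
    intro k
    induction k with
    | zero => simp [hp0]
    | succ k ih =>
      intro hk
      rw [(hstep k hk).2, ih (by omega), Finset.sum_range_succ]
  -- The k-th projection kills the sum of the earlier ones; these are orthogonal by induction, so
  -- their sum fixes each of them.
  have horth : ∀ k < d, ∀ j < k, shiftProj A P k * shiftProj A P j = 0 := by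
    intro k
    induction k using Nat.strong_induction_on with
    | _ k ih =>
      intro hk j hj
      have h1 := hmul k hk
      rw [hp k hk] at h1
      have h2 : (∑ i ∈ Finset.range k, shiftProj A P i) * shiftProj A P j = shiftProj A P j := by
        rw [Finset.sum_mul, Finset.sum_eq_single j, shiftProj_mul_self hA' hP]
        · intro i hi hij
          rcases Nat.lt_or_gt_of_ne hij with h | h
          · have := congrArg star (ih j hj (by omega) i h)
            rwa [star_mul, star_shiftProj hP, star_shiftProj hP, star_zero] at this
          · exact ih i (Finset.mem_range.1 hi) (by have := Finset.mem_range.1 hi; omega) j h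
        · intro h
          exact absurd (Finset.mem_range.2 hj) h
      rw [← h2, ← mul_assoc, h1, zero_mul]
  refine ⟨⟨hA, hA', hAd, hP, ?_, ?_⟩, hmul⟩
  · intro j hj k hk hjk
    rcases Nat.lt_or_gt_of_ne hjk with h | h
    · have := congrArg star (horth k hk j h)
      rwa [star_mul, star_shiftProj hP, star_shiftProj hP, star_zero] at this
    · exact horth j hj k h
  · obtain ⟨k, rfl⟩ : ∃ k, d = k + 1 := ⟨d - 1, by omega⟩
    rw [Finset.sum_range_succ, ← hp k (by omega)]
    exact (hlast k rfl).2

end Shift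

/-! ### From weighted combinations of two unitaries to a shift. -/

section FirstParty

set_option linter.unusedSectionVars false

variable {R : Type*} [Ring R] [Algebra ℂ R] [StarRing R] [StarModule ℂ R]
variable {m d : ℕ}

lemma two_mul_cos_eq (hd : d ≠ 0) (m : ℕ) :
    ((2 * Real.cos (Real.pi / (2 * m)) : ℝ) : ℂ) =
      omegaPow d (d / (4 * m)) + omegaPow d (-(d / (4 * m))) := by
  have := omegaPow_add_omegaPow_neg hd (1 / (4 * m))
  rw [mul_one_div] at this
  rw [this]
  congr 3
  rcases eq_or_ne (m : ℝ) 0 with h | h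
  · simp [h]
  · field_simp
    norm_num

lemma two_mul_cos_ne_zero (hm : 2 ≤ m) : ((2 * Real.cos (Real.pi / (2 * m)) : ℝ) : ℂ) ≠ 0 := by
  have := cos_pi_div_two_mul_pos hm
  exact_mod_cast (by positivity : (2 * Real.cos (Real.pi / (2 * m)) : ℝ) ≠ 0)

lemma star_aCoeff (m d k : ℕ) : star (aCoeff m d k) =
    omegaPow d (-((2 * k - d) / (4 * m))) / ((2 * Real.cos (Real.pi / (2 * m)) : ℝ) : ℂ) := by
  rw [aCoeff, star_div₀, star_omegaPow, Complex.star_def, Complex.conj_ofReal]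

/-- The combination of two phases with weights `a_k` and `a_k^*`. -/
lemma aCoeff_mul_add_low (hd : d ≠ 0) (hm : 2 ≤ m) (k : ℕ) (r : ℝ) :
    aCoeff m d k * omegaPow d (k * r) + star (aCoeff m d k) * omegaPow d (k * (r + 1 / m)) =
      omegaPow d (k * (r + 1 / (2 * m))) := by
  have hc := two_mul_cos_ne_zero hm
  rw [star_aCoeff, aCoeff, div_mul_eq_mul_div, div_mul_eq_mul_div, ← add_div, div_eq_iff hc,
    two_mul_cos_eq hd, mul_add (omegaPow d _), ← omegaPow_add, ← omegaPow_add, ← omegaPow_add,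
    ← omegaPow_add, add_comm]
  congr 2 <;> field_simp <;> ring

/-- The weights also interpolate the exponent k - d. This is the phase of a twist on the range of
its projection, and of the entries of a cyclic shift that wrap around. -/
lemma aCoeff_mul_add_high (hd : d ≠ 0) (hm : 2 ≤ m) (k : ℕ) (r : ℝ) :
    aCoeff m d k * omegaPow d (k * r - d * r) +
      star (aCoeff m d k) * omegaPow d (k * (r + 1 / m) - d * (r + 1 / m)) =
      omegaPow d (k * (r + 1 / (2 * m)) - d * (r + 1 / (2 * m))) := by
  have hc := two_mul_cos_ne_zero hm
  rw [star_aCoeff, aCoeff, div_mul_eq_mul_div, div_mul_eq_mul_div, ← add_div, div_eq_iff hc,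
    two_mul_cos_eq hd, mul_add (omegaPow d _), ← omegaPow_add, ← omegaPow_add, ← omegaPow_add,
    ← omegaPow_add]
  congr 2 <;> field_simp <;> ring

lemma aCoeff_smul_twist (hd : d ≠ 0) (hm : 2 ≤ m) (r : ℝ) (P : R) :
    aCoeff m d 1 • twist d r P + star (aCoeff m d 1) • twist d (r + 1 / m) P =
      twist d (r + 1 / (2 * m)) P := by
  have h1 := aCoeff_mul_add_low hd hm 1 r
  have h2 := aCoeff_mul_add_high hd hm 1 r
  simp only [Nat.cast_one, one_mul] at h1 h2
  rw [twist, twist, twist, ← h1, ← h2]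
  module

/-- Two unitaries whose `a_1`-weighted combination is unitary differ by a two-valued phase. -/
lemma exists_projection_of_unitary_combination (hd : d ≠ 0) (hm : 2 ≤ m) {A B : R}
    (hA : star A * A = 1) (hA' : A * star A = 1) (hB : star B * B = 1) (hB' : B * star B = 1)
    (hC : star (aCoeff m d 1 • A + star (aCoeff m d 1) • B) *
      (aCoeff m d 1 • A + star (aCoeff m d 1) • B) = 1) :
    ∃ P : R, IsStarProjection P ∧ B = A * twist d (1 / m) P := by
  have hc := two_mul_cos_ne_zero hm
  have hc2 := two_mul_cos_eq hd m
  set c : ℂ := ((2 * Real.cos (Real.pi / (2 * m)) : ℝ) : ℂ) with hcdef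
  set y : ℂ := omegaPow d (d / (2 * m)) with hy
  set y' : ℂ := omegaPow d (-(d / (2 * m))) with hy'
  have hyy : y * y' = 1 := omegaPow_mul_neg _ _
  have hcsq : c ^ 2 = y + y' + 2 := by
    rw [hc2, hy, hy', show (d : ℝ) / (2 * m) = d / (4 * m) + d / (4 * m) by field_simp; ring,
      neg_add, omegaPow_add, omegaPow_add]
    linear_combination 2 * omegaPow_mul_neg d (d / (4 * m))
  have hyne : y' * y' ≠ 1 := by
    have h1 := omegaPow_dim_mul_ne_one hd (r := 1 / m) (by positivity)
      ((div_lt_one (by positivity)).2 (by exact_mod_cast hm))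
    intro h
    apply h1
    have h2 : omegaPow d (d * (1 / m)) = y * y := by
      rw [hy, ← omegaPow_add]; congr 1; field_simp; ring
    rw [h2]
    linear_combination (y * y' + 1) * hyy - y * y * h
  set G : R := omegaPow d (-(1 / m)) • (star A * B) with hG
  have hGs : star G = omegaPow d (1 / m) • (star B * A) := by
    rw [hG, star_smul, star_mul, star_star, star_omegaPow, neg_neg]
  have hGG : G * star G = 1 := by
    rw [hGs, hG, smul_mul_smul_comm, omegaPow_neg_mul, one_smul, mul_assoc, ← mul_assoc B, hB',
      one_mul, hA]
  -- Unitarity of the combination, multiplied by c² = y + y' + 2, where y = exp(πi/m).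
  have hrel : y • G + y' • star G = (y + y') • (1 : R) := by
    have h1 := congrArg (c ^ 2 • ·) hC
    have e1 : c ^ 2 * (star (aCoeff m d 1) * star (aCoeff m d 1)) =
        y * omegaPow d (-(1 / m)) := by
      rw [star_aCoeff, ← hcdef, hy, ← omegaPow_add]
      field_simp
      rw [sq, ← omegaPow_add]
      congr 1
      push_cast
      field_simp
      ring
    have e2 : c ^ 2 * (aCoeff m d 1 * aCoeff m d 1) = y' * omegaPow d (1 / m) := by
      rw [aCoeff, ← hcdef, hy', ← omegaPow_add]
      field_simp
      rw [sq, ← omegaPow_add]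
      congr 1
      push_cast
      field_simp
      ring
    have e3 : c ^ 2 * (star (aCoeff m d 1) * aCoeff m d 1) = 1 := by
      rw [star_aCoeff, aCoeff, ← hcdef]
      field_simp
      rw [omegaPow_neg_mul]
    simp only [star_add, star_smul, star_star, add_mul, mul_add, smul_mul_smul_comm, hA, hB,
      smul_add, smul_smul] at h1
    rw [e1, e2, mul_comm (aCoeff m d 1) (star _), e3, hcsq] at h1
    rw [hGs, hG, smul_smul, smul_smul]
    rw [← sub_eq_zero] at h1 ⊢
    rw [← h1]
    module
  -- A quadratic equation with roots 1 and y'², distinct because m ≥ 2. The projection sought is the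
  -- spectral projection of `G` for y'².
  have hquad : G * G = (1 + y' * y') • G - (y' * y') • (1 : R) := by
    have h1 := congrArg (fun X => y' • (G * X)) hrel
    simp only [mul_add, mul_smul_comm, hGG, mul_one, smul_add, smul_smul, mul_comm y' y, hyy,
      one_smul] at h1
    rw [eq_sub_iff_add_eq, h1]
  have hstar : star G = (y * y + 1) • (1 : R) - (y * y) • G := by
    have h1 := congrArg (y • ·) hrel
    simp only [smul_add, smul_smul, hyy, one_smul] at h1
    rw [eq_sub_iff_add_eq, add_comm, h1]
    congr 1
    linear_combination hyy
  set z : ℂ := y' * y' with hz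
  have hz1 : 1 - z ≠ 0 := sub_ne_zero.2 hyne.symm
  have hzz : z * (y * y) = 1 := by rw [hz]; linear_combination (y * y' + 1) * hyy
  have hzs : star z = y * y := by
    rw [hz, star_mul', hy', star_omegaPow, neg_neg]
  have hz2 : 1 - y * y ≠ 0 := by
    rw [← hzs, ← star_one, ← star_sub]
    exact star_ne_zero.2 hz1
  refine ⟨(1 - z)⁻¹ • (1 - G), ⟨?_, ?_⟩, ?_⟩
  · have h1 : (1 - G) * (1 - G) = (1 - z) • (1 - G) := by
      rw [sub_mul, mul_sub, mul_sub, hquad, one_mul, mul_one, one_mul]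
      module
    rw [IsIdempotentElem, smul_mul_smul_comm, h1, smul_smul, mul_assoc, inv_mul_cancel₀ hz1,
      mul_one]
  · have h1 : (1 - y * y)⁻¹ * (-(y * y)) = (1 - z)⁻¹ := by
      rw [inv_mul_eq_iff_eq_mul₀ hz2, eq_mul_inv_iff_mul_eq₀ hz1]
      linear_combination hzz
    rw [IsSelfAdjoint, star_smul, star_sub, star_one, hstar, star_inv₀, star_sub, star_one, hzs,
      ← h1, mul_smul (1 - y * y)⁻¹]
    congr 1
    module
  · have h1 : omegaPow d (-(d * (1 / m))) = z := by
      rw [hz, hy', ← omegaPow_add]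
      congr 1
      field_simp
      norm_num
    rw [twist_eq, h1, smul_smul, mul_inv_cancel₀ hz1, one_smul, sub_sub_cancel, hG, smul_smul,
      omegaPow_mul_neg, one_smul, ← mul_assoc, hA', one_mul]

/-- `B` and `C` are, up to phases, `A * (1 - t • P)` for two different t, and `hCk` relates their
powers. So `isShift_of_pow_eq` applies to `A`, and its projections turn out to be those of `C`. -/
lemma isShift_of_combination_pow (hd : d ≠ 0) (hm : 2 ≤ m) {A B : R}
    (hA : star A * A = 1) (hA' : A * star A = 1) (hB : star B * B = 1) (hB' : B * star B = 1)
    (hAd : A ^ d = 1) (hBd : B ^ d = 1)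
    {C : R} (hC : C = aCoeff m d 1 • A + star (aCoeff m d 1) • B)
    (hCu : star C * C = 1) (hCu' : C * star C = 1) (hCd : C ^ d = 1)
    (hCk : ∀ k, 1 ≤ k → k < d → aCoeff m d k • A ^ k + star (aCoeff m d k) • B ^ k = C ^ k) :
    ∃ P : R, B = A * twist d (1 / m) P ∧ C = A * twist d (1 / (2 * m)) P ∧ IsShift d C P := by
  obtain ⟨P, hP, hBP⟩ := exists_projection_of_unitary_combination hd hm hA hA' hB hB' (hC ▸ hCu)
  have hCP : C = A * twist d (1 / (2 * m)) P := by
    have := aCoeff_smul_twist hd hm 0 P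
    rw [zero_add, zero_add, twist_zero] at this
    rw [hC, hBP, ← this, mul_add, mul_smul_comm, mul_smul_comm, mul_one]
  refine ⟨P, hBP, hCP, ?_⟩
  set z : ℂ := omegaPow d (-(d * (1 / (2 * m)))) with hz
  have hzz : omegaPow d (-(d * (1 / m))) = z * z := by
    rw [hz, ← omegaPow_add]
    congr 1
    field_simp
    norm_num
  have hne : ∀ r : ℝ, 0 < r → r < 1 → omegaPow d (-(d * r)) ≠ 1 := by
    intro r h0 h1 h
    apply omegaPow_dim_mul_ne_one hd h0 h1
    have := omegaPow_mul_neg d (d * r)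
    rwa [h, mul_one] at this
  have hm2 : (2 : ℝ) ≤ m := by exact_mod_cast hm
  have hz1 : z ≠ 1 := hne _ (by positivity) ((div_lt_one (by positivity)).2 (by linarith))
  have hzz1 : z * z ≠ 1 := hzz ▸ hne _ (by positivity) ((div_lt_one (by positivity)).2 (by linarith))
  have hz0 : z ≠ 0 := omegaPow_ne_zero _ _
  have hB1 : A * (1 - (1 - z * z) • P) = omegaPow d (-(1 / m)) • B := by
    rw [hBP, twist_eq, hzz, mul_smul_comm, smul_smul, omegaPow_neg_mul, one_smul]
  have hC1 : A * (1 - (1 - z) • P) = omegaPow d (-(1 / (2 * m))) • C := by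
    rw [hCP, twist_eq, mul_smul_comm, smul_smul, omegaPow_neg_mul, one_smul]
  have hd0 : 0 < d := Nat.pos_of_ne_zero hd
  -- Solves the required form of `B ^ k` for `p k`; by `hCk` and the two interpolation identities
  -- the same `p k` also serves `C ^ k`.
  set p : ℕ → R := fun k =>
    (1 - z * z)⁻¹ • (1 - omegaPow d (-(k * (1 / m))) • (star A ^ k * B ^ k)) with hp
  have hBk : ∀ k : ℕ, B ^ k = omegaPow d (k * (1 / m)) • (A ^ k * (1 - (1 - z * z) • p k)) := by
    intro k
    simp only [hp]
    rw [smul_smul, mul_inv_cancel₀ (sub_ne_zero.2 hzz1.symm), one_smul, sub_sub_cancel,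
      mul_smul_comm, ← mul_assoc, pow_mul_star_pow hA', one_mul, smul_smul, omegaPow_mul_neg,
      one_smul]
  have hCk' : ∀ k < d, C ^ k = omegaPow d (k * (1 / (2 * m))) • (A ^ k * (1 - (1 - z) • p k)) := by
    intro k hk
    rcases Nat.eq_zero_or_pos k with rfl | hk0
    · simp [hp, omegaPow_zero]
    · clear_value p
      have h1 := aCoeff_mul_add_low hd hm k 0
      have h2 := aCoeff_mul_add_high hd hm k 0
      simp only [mul_zero, zero_add, omegaPow_zero, mul_one, sub_zero] at h1 h2
      rw [sub_eq_add_neg, omegaPow_add, hzz, sub_eq_add_neg, omegaPow_add, ← hz] at h2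
      rw [← hCk k hk0 hk, hBk, mul_sub, mul_sub, mul_one, mul_smul_comm, mul_smul_comm]
      set x := omegaPow d (k * (1 / m))
      set x' := omegaPow d (k * (1 / (2 * m)))
      have h3 : star (aCoeff m d k) * x * (1 - z * z) = x' * (1 - z) := by
        linear_combination h1 - h2
      have h4 : star (aCoeff m d k) * x = x' - aCoeff m d k := by
        linear_combination h1
      rw [smul_smul, smul_sub, smul_smul, smul_sub, smul_smul, h3, h4]
      module
  obtain ⟨hAshift, hmul⟩ := isShift_of_pow_eq (s := 1 - z) (t := 1 - z * z) hA hA' hAd hP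
    (by
      intro h
      apply hz1
      have : z * (z - 1) = 0 := by linear_combination h
      exact sub_eq_zero.1 ((mul_eq_zero.1 this).resolve_left hz0))
    (sub_ne_zero.2 hz1.symm) (sub_ne_zero.2 hzz1.symm)
    (by
      intro h
      have : z * z = 0 := by linear_combination -h
      exact hz0 (mul_self_eq_zero.1 this)) p
    (by
      intro k _
      rw [hB1, smul_pow, hBk, smul_smul, omegaPow_pow, mul_neg, omegaPow_neg_mul, one_smul])
    (by
      intro k hk
      rw [hC1, smul_pow, hCk' k hk, smul_smul, omegaPow_pow, mul_neg, omegaPow_neg_mul, one_smul])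
    (by
      rw [hB1, smul_pow, hBd, omegaPow_pow, mul_neg, hzz, sub_sub_cancel]) hd0
  -- `C ^ k` is `A ^ k` times a phase and a factor `1 - (1 - z) • p k`, which is invisible to the
  -- k-th projection because that projection annihilates `p k`.
  have hQ : ∀ k < d, shiftProj C P k = shiftProj A P k := by
    intro k hk
    have h1 : star C ^ k = omegaPow d (-(k * (1 / (2 * m)))) •
        (star (1 - (1 - z) • p k) * star A ^ k) := by
      rw [← star_pow, hCk' k hk, star_smul, star_omegaPow, star_mul, star_pow]
    have h2 : shiftProj A P k * (1 - (1 - z) • p k) = shiftProj A P k := by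
      rw [mul_sub, mul_smul_comm, hmul k hk, smul_zero, sub_zero, mul_one]
    have h3 : star (1 - (1 - z) • p k) * shiftProj A P k = shiftProj A P k := by
      have := congrArg star h2
      rwa [star_mul, star_shiftProj hP] at this
    calc shiftProj C P k = star (1 - (1 - z) • p k) * (shiftProj A P k * (1 - (1 - z) • p k)) := by
          rw [shiftProj, h1, hCk' k hk, smul_mul_assoc, smul_mul_smul_comm, omegaPow_neg_mul,
            one_smul, shiftProj]
          simp only [mul_assoc]
      _ = shiftProj A P k := by rw [h2, h3]
  refine ⟨hCu, hCu', hCd, hP, ?_, ?_⟩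
  · intro j hj k hk hjk
    rw [hQ j hj, hQ k hk]
    exact hAshift.orthogonal j hj k hk hjk
  · rw [← hAshift.sum_eq_one]
    exact Finset.sum_congr rfl fun j hj => hQ j (Finset.mem_range.1 hj)

end FirstParty

end ASTA

namespace ASTA
open Matrix

set_option linter.unusedSectionVars false

/-! ### The ideal observables as phased cyclic shifts. -/

section IdealMatrices

/-- The cyclic shift `|j⟩ ↦ |j - 1⟩`. -/
def lower (d : ℕ) : Matrix (Fin d) (Fin d) ℂ :=
  Matrix.of fun a b => if (b : ℕ) = (a + 1) % d then 1 else 0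

/-- The projection on the first basis vector. -/
def firstProj (d : ℕ) : Matrix (Fin d) (Fin d) ℂ :=
  Matrix.diagonal fun j => if (j : ℕ) = 0 then 1 else 0

lemma lower_apply {d : ℕ} (a b : Fin d) :
    lower d a b = if (b : ℕ) = (a + 1) % d then 1 else 0 := rfl

lemma omegaPow_intCast_eq_one_iff {d : ℕ} (hd : d ≠ 0) (z : ℤ) :
    omegaPow d z = 1 ↔ (d : ℤ) ∣ z := by
  have hd' : (d : ℂ) ≠ 0 := by exact_mod_cast hd
  rw [omegaPow, Complex.exp_eq_one_iff]
  constructor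
  · rintro ⟨k, hk⟩
    refine ⟨k, ?_⟩
    have h1 : (z : ℂ) = d * k := by
      apply mul_left_cancel₀ Complex.two_pi_I_ne_zero
      rw [div_eq_iff hd'] at hk
      push_cast at hk
      linear_combination hk
    exact_mod_cast h1
  · rintro ⟨k, rfl⟩
    refine ⟨k, ?_⟩
    push_cast
    field_simp

lemma sum_omegaPow_mul {d : ℕ} (hd : d ≠ 0) (z : ℤ) :
    ∑ c : Fin d, omegaPow d ((c : ℕ) * (z : ℝ)) = if (d : ℤ) ∣ z then (d : ℂ) else 0 := by
  simp only [← omegaPow_pow]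
  rw [Fin.sum_univ_eq_sum_range (fun c => omegaPow d z ^ c)]
  split_ifs with h
  · rw [(omegaPow_intCast_eq_one_iff hd z).2 h]
    simp
  · have h1 : omegaPow d z ≠ 1 := fun h' => h ((omegaPow_intCast_eq_one_iff hd z).1 h')
    have h2 : omegaPow d z ^ d = 1 := by
      rw [omegaPow_pow]
      have := (omegaPow_intCast_eq_one_iff hd (d * z)).2 (dvd_mul_right _ _)
      exact_mod_cast this
    rw [geom_sum_eq h1, h2, sub_self, zero_div]

lemma dvd_succ_sub_iff {d : ℕ} (a b : Fin d) :
    (d : ℤ) ∣ ((a : ℕ) + 1 - (b : ℕ) : ℤ) ↔ (b : ℕ) = (a + 1) % d := by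
  have hb := b.isLt
  have h1 : (b : ℕ) = (a + 1) % d ↔ (b : ℕ) ≡ a + 1 [MOD d] := by
    rw [Nat.ModEq, Nat.mod_eq_of_lt hb]
  rw [h1, Nat.modEq_iff_dvd]
  push_cast
  rfl

lemma fourier_mul_clock_mul {d : ℕ} (hd : d ≠ 0) :
    fourier d * clock d * (fourier d)ᴴ = lower d := by
  have hs : ((1 / Real.sqrt d : ℝ) : ℂ) * ((1 / Real.sqrt d : ℝ) : ℂ) = 1 / d := by
    rw [← Complex.ofReal_mul, div_mul_div_comm, Real.mul_self_sqrt (Nat.cast_nonneg d)]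
    simp
  have hd' : (d : ℂ) ≠ 0 := by exact_mod_cast hd
  ext a b
  rw [clock, phase, Matrix.mul_apply, lower_apply]
  have h1 : ∀ c : Fin d, (fourier d * diagonal fun j : Fin d => omegaPow d ((j : ℝ) * 1)) a c *
      (fourier d)ᴴ c b = 1 / d * omegaPow d ((c : ℕ) * (((a : ℕ) + 1 - (b : ℕ) : ℤ) : ℝ)) := by
    intro c
    rw [Matrix.mul_diagonal, conjTranspose_apply, fourier, of_apply, of_apply, star_mul',
      star_omegaPow, Complex.star_def, Complex.conj_ofReal, ← hs]
    rw [show ∀ s x y z : ℂ, s * x * y * (s * z) = s * s * (x * y * z) by intros; ring,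
      ← omegaPow_add, ← omegaPow_add]
    congr 2
    push_cast
    ring
  rw [Finset.sum_congr rfl fun c _ => h1 c, ← Finset.mul_sum, sum_omegaPow_mul hd,
    if_congr (dvd_succ_sub_iff a b) rfl rfl]
  split_ifs <;> simp [hd']

/-- The Fourier and clock matrices are symmetric, so this is the transpose of
`fourier_mul_clock_mul`; for the real matrix `lower` that is the adjoint. -/
lemma conjTranspose_fourier_mul_clock_mul {d : ℕ} (hd : d ≠ 0) :
    (fourier d)ᴴ * clock d * fourier d = (lower d)ᴴ := by
  have hT : (fourier d)ᵀ = fourier d := by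
    ext a b
    simp only [fourier, transpose_apply, of_apply]
    rw [mul_comm (a : ℝ)]
  have hc : (clock d)ᵀ = clock d := by rw [clock, phase, diagonal_transpose]
  have hl : (lower d)ᴴ = (lower d)ᵀ := by
    ext a b
    rw [conjTranspose_apply, transpose_apply, lower_apply]
    split_ifs <;> simp
  rw [hl, ← fourier_mul_clock_mul hd, transpose_mul, transpose_mul, hc, hT,
    ← Matrix.mul_assoc, conjTranspose, ← transpose_map, transpose_transpose, ← conjTranspose,
    conjTranspose, hT]

lemma phase_mul_phase (d : ℕ) (r s : ℝ) : phase d r * phase d s = phase d (r + s) := by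
  rw [phase, phase, diagonal_mul_diagonal, phase]
  congr 1
  ext j
  rw [← omegaPow_add, mul_add]

lemma phase_zero (d : ℕ) : phase d 0 = 1 := by
  simp [phase, omegaPow_zero]

lemma conjTranspose_phase (d : ℕ) (r : ℝ) : (phase d r)ᴴ = phase d (-r) := by
  rw [phase, diagonal_conjTranspose, phase]
  congr 1
  ext j
  rw [Pi.star_apply, star_omegaPow, mul_neg]

/-- The cyclic shift conjugated by a diagonal phase. -/
noncomputable def lowerPhase (d : ℕ) (r : ℝ) : Matrix (Fin d) (Fin d) ℂ := phase d (-r) * lower d * phase d r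

lemma lowerPhase_apply {d : ℕ} (r : ℝ) (a b : Fin d) :
    lowerPhase d r a b =
      if (b : ℕ) = (a + 1) % d then omegaPow d (((b : ℝ) - a) * r) else 0 := by
  rw [lowerPhase, phase, phase, mul_diagonal, diagonal_mul, lower_apply]
  split_ifs
  · rw [mul_one, ← omegaPow_add]
    congr 1
    ring
  · simp

lemma phase_conj_lowerPhase (d : ℕ) (r s : ℝ) :
    phase d (-s) * lowerPhase d r * phase d s = lowerPhase d (r + s) := by
  rw [lowerPhase, lowerPhase, ← phase_mul_phase, show -(r + s) = -s + -r by ring,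
    ← phase_mul_phase]
  simp only [Matrix.mul_assoc]

lemma conjTranspose_lowerPhase (d : ℕ) (r : ℝ) :
    (lowerPhase d r)ᴴ = phase d (-r) * (lower d)ᴴ * phase d r := by
  rw [lowerPhase, conjTranspose_mul, conjTranspose_mul, conjTranspose_phase, conjTranspose_phase,
    neg_neg, Matrix.mul_assoc]

lemma idealObs_eq {m d : ℕ} (hd : d ≠ 0) (i x : ℕ) :
    idealObs m d i x =
      if i = 0 then lowerPhase d ((x + 1) / m - 1 / (2 * m))
      else if i = 1 then (lowerPhase d (-((x + 1) / m)))ᴴ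
      else if Even i then lowerPhase d (x / m) else (lowerPhase d (-(x / m)))ᴴ := by
  simp only [idealObs]
  have h1 := fourier_mul_clock_mul hd
  have h2 := conjTranspose_fourier_mul_clock_mul hd
  split_ifs
  · simp only [lowerPhase, ← h1, conjTranspose_phase, neg_neg, Matrix.mul_assoc]
  · simp only [conjTranspose_lowerPhase, ← h2, conjTranspose_phase, neg_neg, Matrix.mul_assoc]
  · simp only [lowerPhase, ← h1, conjTranspose_phase, neg_neg, Matrix.mul_assoc]
  · simp only [conjTranspose_lowerPhase, ← h2, conjTranspose_phase, neg_neg, Matrix.mul_assoc]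

lemma twist_firstProj {d : ℕ} (r : ℝ) : twist d r (firstProj d) =
    diagonal fun j : Fin d => if (j : ℕ) = 0 then omegaPow d (r - d * r) else omegaPow d r := by
  ext a b
  simp only [twist, firstProj, Matrix.add_apply, Matrix.smul_apply, Matrix.sub_apply,
    Matrix.one_apply, diagonal_apply, smul_eq_mul]
  split_ifs <;> simp

/-- Conjugation by the phase gives ω^r on ordinary entries and ω^{(1-d)r} on the one that wraps from
d - 1 to 0; these are the two values of the twist. -/
lemma lower_mul_twist {d : ℕ} (r : ℝ) : lower d * twist d r (firstProj d) = lowerPhase d r := by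
  ext a b
  rw [twist_firstProj, mul_diagonal, lowerPhase_apply, lower_apply]
  by_cases h : (b : ℕ) = (a + 1) % d
  · rw [if_pos h, if_pos h, one_mul]
    rcases Nat.lt_or_ge ((a : ℕ) + 1) d with h1 | h1
    · rw [Nat.mod_eq_of_lt h1] at h
      rw [if_neg (by omega), h]
      congr 1
      push_cast
      ring
    · have h2 : (a : ℕ) + 1 = d := by omega
      rw [h2, Nat.mod_self] at h
      rw [if_pos h, h]
      congr 1
      have : (d : ℝ) = (a : ℕ) + 1 := by exact_mod_cast h2.symm
      rw [this]
      push_cast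
      ring
  · rw [if_neg h, if_neg h, zero_mul]

lemma lowerPhase_pow_apply {d : ℕ} (r : ℝ) {k : ℕ} (a b : Fin d) :
    (lowerPhase d r ^ k) a b =
      if (b : ℕ) = (a + k) % d then omegaPow d (((b : ℝ) - a) * r) else 0 := by
  induction k generalizing b with
  | zero =>
    rw [pow_zero, add_zero, Nat.mod_eq_of_lt a.isLt, Matrix.one_apply]
    by_cases h : a = b
    · simp [h, omegaPow_zero]
    · rw [if_neg h, if_neg fun h' => h (Fin.ext h'.symm)]
  | succ k ih =>
    have hd : 0 < d := a.pos
    rw [pow_succ, Matrix.mul_apply,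
      Finset.sum_eq_single ⟨(a + k) % d, Nat.mod_lt _ hd⟩]
    · rw [ih, if_pos rfl, lowerPhase_apply, Nat.mod_add_mod, add_assoc]
      split_ifs
      · rw [← omegaPow_add]
        congr 1
        ring
      · simp
    · intro c _ hc
      rw [ih, if_neg fun h => hc (Fin.ext h), zero_mul]
    · simp

end IdealMatrices

/-! ### Unitary model of an abstract shift. -/

section Realisation

variable {n : Type*} [Fintype n] [DecidableEq n]

lemma exists_isometry_of_isStarProjection {P : Matrix n n ℂ} (hP : IsStarProjection P) :
    ∃ (D : ℕ) (V : Matrix n (Fin D) ℂ), Vᴴ * V = 1 ∧ V * Vᴴ = P := by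
  have hH : P.IsHermitian := hP.isSelfAdjoint
  set W : Matrix n n ℂ := (hH.eigenvectorUnitary).val with hW
  have hWW : Wᴴ * W = 1 := Unitary.coe_star_mul_self hH.eigenvectorUnitary
  have hWW' : W * Wᴴ = 1 := Unitary.coe_mul_star_self hH.eigenvectorUnitary
  set v : n → ℂ := RCLike.ofReal ∘ hH.eigenvalues with hv
  have hspec : P = W * diagonal v * Wᴴ := by
    have := hH.spectral_theorem
    rwa [Unitary.conjStarAlgAut_apply] at this
  have hvv : ∀ i, v i = 0 ∨ v i = 1 := by
    have h1 : diagonal v * diagonal v = diagonal v := by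
      have h2 : diagonal v = Wᴴ * P * W := by
        rw [hspec]
        simp only [Matrix.mul_assoc, hWW, Matrix.mul_one]
        rw [← Matrix.mul_assoc, hWW, Matrix.one_mul]
      calc diagonal v * diagonal v = Wᴴ * P * (W * Wᴴ) * P * W := by
            rw [h2]; simp only [Matrix.mul_assoc]
        _ = Wᴴ * (P * P) * W := by rw [hWW', Matrix.mul_one, Matrix.mul_assoc Wᴴ P P]
        _ = diagonal v := by rw [hP.isIdempotentElem.eq, h2]
    intro i
    have h3 := congrFun (congrFun h1 i) i
    rw [diagonal_mul_diagonal, diagonal_apply_eq, diagonal_apply_eq] at h3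
    have h4 : v i * (v i - 1) = 0 := by linear_combination h3
    exact (mul_eq_zero.1 h4).imp id sub_eq_zero.1
  let e : Fin (Fintype.card {i // v i = 1}) ≃ {i // v i = 1} := (Fintype.equivFin _).symm
  refine ⟨Fintype.card {i // v i = 1}, W.submatrix id fun s => (e s : n), ?_, ?_⟩
  · ext s t
    have h1 := congrFun (congrFun hWW (e s)) (e t)
    rw [Matrix.one_apply]
    rw [Matrix.one_apply] at h1
    simp only [Subtype.ext_iff.symm, e.injective.eq_iff] at h1
    exact h1
  · rw [hspec]
    ext a b
    rw [Matrix.mul_apply, Matrix.mul_apply]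
    simp only [mul_diagonal, submatrix_apply, conjTranspose_apply, id]
    rw [e.sum_comp (fun s : {i // v i = 1} => W a s * star (W b s)),
      ← Finset.sum_subtype (Finset.univ.filter fun i => v i = 1) (by simp)
        (fun i => W a i * star (W b i)), Finset.sum_filter]
    refine Finset.sum_congr rfl fun i _ => ?_
    rcases hvv i with h | h
    · rw [h, if_neg zero_ne_one]; ring
    · rw [h, if_pos rfl]; ring

/-- A shift is unitarily equivalent to the ideal one tensored with an identity. -/
lemma IsShift.exists_unitary {d : ℕ} {S P : Matrix n n ℂ} (h : IsShift d S P) :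
    ∃ (D : ℕ) (e : n ≃ Fin d × Fin D) (U : Matrix n n ℂ), U ∈ Matrix.unitaryGroup n ℂ ∧
      Matrix.reindex e e (U * S * Uᴴ) = lower d ⊗ₖ (1 : Matrix (Fin D) (Fin D) ℂ) ∧
      Matrix.reindex e e (U * P * Uᴴ) = firstProj d ⊗ₖ (1 : Matrix (Fin D) (Fin D) ℂ) := by
  obtain ⟨D, V, hV, hVP⟩ := exists_isometry_of_isStarProjection h.proj
  have hPV : P * V = V := by rw [← hVP, Matrix.mul_assoc, hV, Matrix.mul_one]
  have hVPV : Vᴴ * P = Vᴴ := by rw [← hVP, ← Matrix.mul_assoc, hV, Matrix.one_mul]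
  have hS' := h.mul_star_self
  have hmid : ∀ X : Matrix n n ℂ, Vᴴ * X * V = Vᴴ * (P * X * P) * V := by
    intro X
    calc Vᴴ * X * V = (Vᴴ * P) * X * (P * V) := by rw [hPV, hVPV]
      _ = Vᴴ * (P * X * P) * V := by simp only [Matrix.mul_assoc]
  have horth : ∀ j < d, ∀ k < d, j ≠ k → P * (S ^ j * star S ^ k) * P = 0 := by
    intro j hj k hk hjk
    have h1 := congrArg (fun X => S ^ j * X * star S ^ k) (h.orthogonal j hj k hk hjk)
    have h2 : S ^ j * (shiftProj S P j * shiftProj S P k) * star S ^ k =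
        (S ^ j * star S ^ j) * (P * (S ^ j * star S ^ k) * P) * (S ^ k * star S ^ k) := by
      simp only [shiftProj, Matrix.mul_assoc]
    simpa [h2, pow_mul_star_pow hS'] using h1
  have hgram : ∀ j < d, ∀ k < d, ∀ s t, (Vᴴ * (S ^ j * star S ^ k) * V) s t =
      if j = k then (1 : Matrix (Fin D) (Fin D) ℂ) s t else 0 := by
    intro j hj k hk s t
    split_ifs with hjk
    · rw [hjk, pow_mul_star_pow hS', Matrix.mul_one, hV]
    · rw [hmid, horth j hj k hk hjk, Matrix.mul_zero, Matrix.zero_mul, Matrix.zero_apply]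
  -- Translates by `star S` of an orthonormal basis of the range of `P`: orthonormal by
  -- orthogonality of the projections, complete because these sum to 1.
  let T : Matrix n (Fin d × Fin D) ℂ := Matrix.of fun a p => (star S ^ (p.1 : ℕ) * V) a p.2
  have hTX : ∀ (X : Matrix n n ℂ) (p q : Fin d × Fin D), (Tᴴ * X * T) p q =
      (Vᴴ * (S ^ (p.1 : ℕ) * X * star S ^ (q.1 : ℕ)) * V) p.2 q.2 := by
    intro X p q
    have h1 : (Tᴴ * X * T) p q =
        ((star S ^ (p.1 : ℕ) * V)ᴴ * X * (star S ^ (q.1 : ℕ) * V)) p.2 q.2 := by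
      simp only [Matrix.mul_apply (M := _ * _), Matrix.mul_apply (M := Tᴴ)]
      simp only [Matrix.mul_apply (M := (star S ^ (p.1 : ℕ) * V)ᴴ)]
      rfl
    rw [h1, conjTranspose_mul, ← star_eq_conjTranspose (star S ^ _), star_pow, star_star]
    simp only [Matrix.mul_assoc]
  have hTT : Tᴴ * T = 1 := by
    ext p q
    have h1 := hTX 1 p q
    rw [Matrix.mul_one, Matrix.mul_one] at h1
    rw [h1]
    rw [hgram _ p.1.isLt _ q.1.isLt, Matrix.one_apply, Matrix.one_apply, ← ite_and]
    simp only [Fin.ext_iff, Prod.ext_iff]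
  have hTT' : T * Tᴴ = 1 := by
    rw [← h.sum_eq_one, ← Fin.sum_univ_eq_sum_range]
    ext a b
    rw [Matrix.mul_apply, Fintype.sum_prod_type, Matrix.sum_apply]
    refine Finset.sum_congr rfl fun j _ => ?_
    rw [shiftProj, ← hVP, ← Matrix.mul_assoc, Matrix.mul_assoc, Matrix.mul_apply]
    refine Finset.sum_congr rfl fun s _ => ?_
    rw [show Vᴴ * S ^ (j : ℕ) = (star S ^ (j : ℕ) * V)ᴴ by
      rw [conjTranspose_mul, ← star_eq_conjTranspose (star S ^ _), star_pow, star_star]]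
    rfl
  -- The trace of `T * Tᴴ` counts both index sets.
  have hcard : Fintype.card n = Fintype.card (Fin d × Fin D) := by
    have h1 := Matrix.trace_mul_comm T Tᴴ
    rw [hTT, hTT', Matrix.trace_one, Matrix.trace_one] at h1
    exact_mod_cast h1
  let e : n ≃ Fin d × Fin D := Fintype.equivOfCardEq hcard
  have hconj : ∀ X : Matrix n n ℂ,
      Matrix.reindex e e ((T.submatrix id e)ᴴ * X * ((T.submatrix id e)ᴴ)ᴴ) = Tᴴ * X * T := by
    intro X
    rw [conjTranspose_conjTranspose]
    ext p q
    simp [Matrix.mul_apply]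
  refine ⟨D, e, (T.submatrix id e)ᴴ, ?_, ?_, ?_⟩
  · rw [Matrix.mem_unitaryGroup_iff', star_eq_conjTranspose, conjTranspose_conjTranspose,
      conjTranspose_submatrix, submatrix_mul_equiv, hTT']
    simp
  · rw [hconj]
    ext p q
    have hd : 0 < d := p.1.pos
    rw [hTX, ← pow_succ, pow_eq_pow_mod _ h.pow_eq_one,
      hgram _ (Nat.mod_lt _ hd) _ q.1.isLt, kroneckerMap_apply, lower_apply, ite_mul, one_mul,
      zero_mul]
    exact if_congr eq_comm rfl rfl
  · rw [hconj]
    ext p q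
    have hd : 0 < d := p.1.pos
    rw [hTX, kroneckerMap_apply, firstProj, diagonal_apply]
    have hP0 : ∀ j < d, j ≠ 0 → P * S ^ j * P = 0 := by
      intro j hj hj0
      simpa using horth j hj 0 hd hj0
    have hP0' : ∀ k < d, k ≠ 0 → P * star S ^ k * P = 0 := by
      intro k hk hk0
      simpa using horth 0 hd k hk hk0.symm
    have h3 : P * (S ^ (p.1 : ℕ) * P * star S ^ (q.1 : ℕ)) * P =
        (P * S ^ (p.1 : ℕ) * P) * (P * star S ^ (q.1 : ℕ) * P) := by
      rw [← h.proj.isIdempotentElem.eq]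
      simp only [Matrix.mul_assoc, ← Matrix.mul_assoc P P, h.proj.isIdempotentElem.eq]
    by_cases hp : (p.1 : ℕ) = 0
    · by_cases hq : (q.1 : ℕ) = 0
      · rw [if_pos (Fin.ext (hp.trans hq.symm)), if_pos hp, hp, hq, pow_zero, pow_zero,
          Matrix.one_mul, Matrix.mul_one, hVPV, hV, one_mul]
      · rw [hmid, h3, hP0' _ q.1.isLt hq, if_neg fun h => hq (by rw [← h, hp])]
        simp
    · rw [hmid, h3, hP0 _ p.1.isLt hp, if_neg hp]
      simp

end Realisation

end ASTA

namespace ASTA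
open Matrix

set_option linter.unusedSectionVars false

/-! ### Observables of one party with antiperiodic phases. -/

section Observables

variable {m d : ℕ} {κ : Type*} [Fintype κ] [DecidableEq κ]

lemma IsObservable.star_mul_self {A : Matrix κ κ ℂ} (h : IsObservable d A) : star A * A = 1 :=
  Matrix.mem_unitaryGroup_iff'.1 h.1

lemma IsObservable.mul_star_self {A : Matrix κ κ ℂ} (h : IsObservable d A) : A * star A = 1 :=
  Matrix.mem_unitaryGroup_iff.1 h.1

lemma IsObservable.star {A : Matrix κ κ ℂ} (h : IsObservable d A) : IsObservable d (star A) :=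
  ⟨Unitary.star_mem h.1, by rw [← star_pow, h.2, star_one]⟩

lemma extObs_of_lt (A : Fin m → Matrix κ κ ℂ) {q : ℕ} (hq : q < m) :
    extObs d A q = A ⟨q, hq⟩ := by
  have hm : 0 < m := by omega
  rw [extObs, dif_pos hm, Nat.div_eq_of_lt hq]
  simp [omegaPow_zero, Nat.mod_eq_of_lt hq]

lemma extObs_self (hm : 0 < m) (A : Fin m → Matrix κ κ ℂ) :
    extObs d A m = omegaPow d 1 • extObs d A 0 := by
  rw [extObs_of_lt A hm, extObs, dif_pos hm, Nat.div_self hm]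
  simp [Nat.mod_self]

lemma isObservable_extObs (hd : d ≠ 0) (hm : 0 < m) {A : Fin m → Matrix κ κ ℂ}
    (hA : ∀ x, IsObservable d (A x)) (q : ℕ) : IsObservable d (extObs d A q) := by
  rw [extObs, dif_pos hm]
  have h := hA ⟨q % m, Nat.mod_lt q hm⟩
  refine ⟨?_, ?_⟩
  · rw [Matrix.mem_unitaryGroup_iff', star_smul, smul_mul_smul_comm, h.star_mul_self,
      star_omegaPow, omegaPow_neg_mul, one_smul]
  · rw [smul_pow, h.2, omegaPow_pow, ← mul_comm, ← omegaPow_pow, omegaPow_dim hd, one_pow,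
      one_smul]

/-- The combination `a_k A_x^k + a_k^* A_{x+1}^k` of the observables of the first party. -/
noncomputable def firstFactor (d : ℕ) (A : Fin m → Matrix κ κ ℂ) (k x : ℕ) : Matrix κ κ ℂ :=
  aCoeff m d k • extObs d A x ^ k + star (aCoeff m d k) • extObs d A (x + 1) ^ k

/-- The powers of the observables, with the phases that make them antiperiodic. -/
noncomputable def phasedPow (d : ℕ) (A : Fin m → Matrix κ κ ℂ) (k x : ℕ) : Matrix κ κ ℂ :=
  omegaPow d (-((2 * k - d) * x / (2 * m))) • extObs d A x ^ k

lemma isometry_pow {A : Matrix κ κ ℂ} (hA : star A * A = 1) (k : ℕ) : star (A ^ k) * A ^ k = 1 := by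
  rw [star_pow, star_pow_mul_pow hA]

lemma isometry_phasedPow (hd : d ≠ 0) (hm : 0 < m) {A : Fin m → Matrix κ κ ℂ}
    (hA : ∀ x, IsObservable d (A x)) (k x : ℕ) :
    star (phasedPow d A k x) * phasedPow d A k x = 1 := by
  rw [phasedPow, star_smul, smul_mul_smul_comm,
    isometry_pow (isObservable_extObs hd hm hA x).star_mul_self, star_omegaPow, omegaPow_neg_mul,
    one_smul]

/-- The factor ω^k from A_{x+m} = ωA_x and the phase ω^{-(2k-d)/2} combine to ω^{d/2} = -1. -/
lemma phasedPow_self (hd : d ≠ 0) (hm : 0 < m) (A : Fin m → Matrix κ κ ℂ) (k : ℕ) :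
    phasedPow d A k m = -phasedPow d A k 0 := by
  have h1 : omegaPow d (d * (1 / 2)) = -1 := by
    rw [omegaPow_dim_mul hd, show 2 * Real.pi * (1 / 2) = Real.pi by ring, Complex.exp_pi_mul_I]
  rw [phasedPow, phasedPow, extObs_self hm, smul_pow, smul_smul, omegaPow_pow, ← omegaPow_add,
    show -((2 * k - d) * m / (2 * m)) + (k : ℝ) * 1 = d * (1 / 2) by field_simp; ring, h1]
  simp [omegaPow_zero]

lemma firstFactor_eq (hm : 0 < m) (A : Fin m → Matrix κ κ ℂ) (k x : ℕ) :
    firstFactor d A k x =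
      (omegaPow d ((2 * k - d) / (4 * m) + (2 * k - d) * x / (2 * m)) /
        ((2 * Real.cos (Real.pi / (2 * m)) : ℝ) : ℂ)) •
      (phasedPow d A k x + phasedPow d A k (x + 1)) := by
  rw [firstFactor, phasedPow, phasedPow, smul_add, smul_smul, smul_smul, star_aCoeff, aCoeff,
    div_mul_eq_mul_div, div_mul_eq_mul_div, ← omegaPow_add, ← omegaPow_add]
  congr 4
  · ring
  · push_cast
    field_simp
    ring

/-- Here a_{d-1} = a_1^* and A^{d-1} = A†. This later makes the combination for k = 1 unitary. -/
lemma star_firstFactor_one (hd : 2 ≤ d) (hm : 0 < m) {A : Fin m → Matrix κ κ ℂ}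
    (hA : ∀ x, IsObservable d (A x)) (x : ℕ) :
    star (firstFactor d A 1 x) = firstFactor d A (d - 1) x := by
  have h1 : aCoeff m d (d - 1) = star (aCoeff m d 1) := by
    rw [star_aCoeff, aCoeff, Nat.cast_sub (by omega)]
    congr 2
    push_cast
    ring
  have h2 : ∀ q, extObs d A q ^ (d - 1) = star (extObs d A q) := by
    intro q
    have h := isObservable_extObs (by omega) hm hA q
    calc extObs d A q ^ (d - 1) = extObs d A q ^ (d - 1) * (extObs d A q * star (extObs d A q)) := by
          rw [h.mul_star_self, mul_one]
      _ = star (extObs d A q) := by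
          rw [← mul_assoc, ← pow_succ, Nat.sub_add_cancel (by omega), h.2, one_mul]
  rw [firstFactor, firstFactor, h1, h2, h2, star_star, star_add, star_smul, star_smul, star_star,
    pow_one, pow_one]

end Observables

/-! ### The sum of squares, the bound, and the first party at the maximum. -/

section BellBound

universe u

variable {N m d : ℕ} {n : Fin N → Type u} [∀ i, Fintype (n i)] [∀ i, DecidableEq (n i)]
  {A : ∀ i, Fin m → Matrix (n i) (n i) ℂ} {ρ : Matrix (∀ i, n i) (∀ i, n i) ℂ}

lemma settingIndex_zero (hN : 2 ≤ N) (α : Fin (N - 1) → Fin m) :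
    settingIndex α 0 = α ⟨0, by omega⟩ := by
  rw [settingIndex, dif_pos]

lemma bellFactor_zero (i : Fin N) (hi : (i : ℕ) = 0) (α : Fin (N - 1) → Fin m) (k : ℕ) :
    bellFactor d A α k i = firstFactor d (A i) k (settingIndex α 0) := by
  rw [bellFactor, if_pos hi, firstFactor]

lemma isObservable_bellFactor_one (hd : d ≠ 0) (hm : 0 < m) (hA : ∀ i x, IsObservable d (A i x))
    (α : Fin (N - 1) → Fin m) {i : Fin N} (hi : (i : ℕ) ≠ 0) :
    IsObservable d (bellFactor d A α 1 i) := by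
  rw [bellFactor, if_neg hi]
  split_ifs
  · rw [pow_one]
    exact isObservable_extObs hd hm (hA i) _
  · rw [pow_one]
    exact (isObservable_extObs hd hm (hA i) _).star

lemma bellFactor_eq_pow (α : Fin (N - 1) → Fin m) (k : ℕ) {i : Fin N} (hi : (i : ℕ) ≠ 0) :
    bellFactor d A α k i = bellFactor d A α 1 i ^ k := by
  rw [bellFactor, bellFactor, if_neg hi, if_neg hi]
  split_ifs <;> rw [pow_one]

/-- The Bell term without the factor of the first party. -/
noncomputable def restTerm (d : ℕ) (A : ∀ i, Fin m → Matrix (n i) (n i) ℂ)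
    (α : Fin (N - 1) → Fin m) : Matrix (∀ i, n i) (∀ i, n i) ℂ :=
  tensor fun i => if (i : ℕ) = 0 then 1 else bellFactor d A α 1 i

/-- Only the first party fails to contribute a k-th power; the rest is the power of one unitary,
which drops out of expectations of squares. -/
lemma tensor_bellFactor {i₀ : Fin N} (hi₀ : (i₀ : ℕ) = 0) (α : Fin (N - 1) → Fin m) (k : ℕ) :
    tensor (bellFactor d A α k) =
      restTerm d A α ^ k * locHom n i₀ (firstFactor d (A i₀) k (settingIndex α 0)) := by
  rw [restTerm, tensor_pow, locHom_apply, tensor_mul]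
  congr 1
  ext1 i
  by_cases hi : i = i₀
  · subst hi
    rw [bellFactor_zero i hi₀, if_pos hi₀, one_pow, one_mul, Function.update_self]
  · have hi' : (i : ℕ) ≠ 0 := fun h => hi (Fin.ext (h.trans hi₀.symm))
    rw [if_neg hi', Function.update_of_ne hi, mul_one, bellFactor_eq_pow α k hi']

lemma restTerm_mul_locHom {i₀ : Fin N} (hi₀ : (i₀ : ℕ) = 0) (α : Fin (N - 1) → Fin m)
    (X : Matrix (n i₀) (n i₀) ℂ) :
    restTerm d A α * locHom n i₀ X = locHom n i₀ X * restTerm d A α := by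
  rw [restTerm, locHom_apply, tensor_mul, tensor_mul]
  congr 1
  ext1 i
  by_cases hi : i = i₀
  · subst hi
    simp [hi₀]
  · rw [Function.update_of_ne hi, mul_one, one_mul]

lemma isObservable_restTerm (hd : d ≠ 0) (hm : 0 < m) (hA : ∀ i x, IsObservable d (A i x))
    (α : Fin (N - 1) → Fin m) : IsObservable d (restTerm d A α) := by
  refine ⟨?_, ?_⟩
  · rw [Matrix.mem_unitaryGroup_iff', star_eq_conjTranspose, restTerm, conjTranspose_tensor,
      tensor_mul, ← tensor_one]
    congr 1
    ext1 i
    split_ifs with hi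
    · simp
    · exact (isObservable_bellFactor_one hd hm hA α hi).star_mul_self
  · rw [restTerm, tensor_pow, ← tensor_one]
    congr 1
    ext1 i
    split_ifs with hi
    · simp
    · exact (isObservable_bellFactor_one hd hm hA α hi).2

lemma sqExp_tensor_bellFactor (hd : d ≠ 0) (hm : 0 < m) (hA : ∀ i x, IsObservable d (A i x))
    {i₀ : Fin N} (hi₀ : (i₀ : ℕ) = 0) (α : Fin (N - 1) → Fin m) (k : ℕ) :
    sqExp ρ (tensor (bellFactor d A α k)) =
      sqExp ρ (locHom n i₀ (firstFactor d (A i₀) k (settingIndex α 0))) := by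
  rw [tensor_bellFactor hi₀, sqExp_unitary_mul]
  rw [← star_eq_conjTranspose]
  exact isometry_pow (isObservable_restTerm hd hm hA α).star_mul_self k

lemma sum_sqExp_firstFactor (hρ : IsState ρ) (hd : d ≠ 0) (hm : 2 ≤ m)
    (hA : ∀ i x, IsObservable d (A i x)) (i₀ : Fin N) (k : ℕ) :
    ∑ x ∈ Finset.range m, sqExp ρ (locHom n i₀ (firstFactor d (A i₀) k x)) ≤ m ∧
    (∑ x ∈ Finset.range m, sqExp ρ (locHom n i₀ (firstFactor d (A i₀) k x)) = m →
      ∀ x, x + 2 ≤ m → locHom n i₀ (phasedPow d (A i₀) k (x + 2)) * ρ =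
        locHom n i₀ (((2 * Real.cos (Real.pi / m) : ℝ) : ℂ) • phasedPow d (A i₀) k (x + 1) -
          phasedPow d (A i₀) k x) * ρ) := by
  have hm' : 0 < m := by omega
  have hc := cos_pi_div_two_mul_pos hm
  obtain ⟨h1, h2⟩ := sum_sqExp_antiperiodic hρ hm (fun x => locHom n i₀ (phasedPow d (A i₀) k x))
    (by
      intro x
      rw [← star_eq_conjTranspose, ← map_star, ← map_mul, isometry_phasedPow hd hm' (hA i₀),
        map_one])
    (by simp only [phasedPow_self hd hm', map_neg])
  have h3 : ∀ x, sqExp ρ (locHom n i₀ (phasedPow d (A i₀) k x) +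
      locHom n i₀ (phasedPow d (A i₀) k (x + 1))) = 4 * Real.cos (Real.pi / (2 * m)) ^ 2 *
        sqExp ρ (locHom n i₀ (firstFactor d (A i₀) k x)) := by
    intro x
    rw [firstFactor_eq hm', map_smul, map_add, sqExp_smul, Complex.normSq_div,
      Complex.normSq_eq_norm_sq, norm_omegaPow, Complex.normSq_ofReal, one_pow]
    field_simp
    norm_num
  simp only [h3, ← Finset.mul_sum] at h1 h2
  have hpos : 0 < 4 * Real.cos (Real.pi / (2 * m)) ^ 2 := by positivity
  refine ⟨le_of_mul_le_mul_left h1 hpos, fun h => ?_⟩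
  have h4 := h2 (by rw [h])
  intro x hx
  rw [map_sub, map_smul]
  exact h4 x hx

lemma sum_setting_zero (hN : 2 ≤ N) (f : ℕ → ℝ) :
    ∑ α : Fin (N - 1) → Fin m, f (settingIndex α 0) =
      (m : ℝ) ^ (N - 2) * ∑ x ∈ Finset.range m, f x := by
  have h := Fintype.sum_piFinset_apply (fun x : Fin m => f x) (Finset.univ : Finset (Fin m))
    (⟨0, by omega⟩ : Fin (N - 1))
  rw [Fintype.piFinset_univ] at h
  simp only [settingIndex_zero hN]
  rw [h, Fin.sum_univ_eq_sum_range, Finset.card_univ, Fintype.card_fin, Fintype.card_fin,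
    nsmul_eq_mul, Nat.cast_pow, Nat.sub_sub]

/-- The sum-of-squares decomposition of the Bell value. -/
lemma two_mul_bellValue_add (hρ : IsState ρ) (hN : 2 ≤ N) (hd : 2 ≤ d) (hm : 2 ≤ m)
    (hA : ∀ i x, IsObservable d (A i x)) {i₀ : Fin N} (hi₀ : (i₀ : ℕ) = 0) :
    2 * bellValue d A ρ + ∑ α : Fin (N - 1) → Fin m, ∑ k ∈ Finset.Icc 1 (d - 1),
        sqExp ρ (1 - tensor (bellFactor d A α k)) =
      (m : ℝ) ^ (N - 1) * (d - 1) + (m : ℝ) ^ (N - 2) * ∑ k ∈ Finset.Icc 1 (d - 1),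
        ∑ x ∈ Finset.range m, sqExp ρ (locHom n i₀ (firstFactor d (A i₀) k x)) := by
  have h1 : 2 * bellValue d A ρ = ∑ α : Fin (N - 1) → Fin m, ∑ k ∈ Finset.Icc 1 (d - 1),
      (1 + sqExp ρ (locHom n i₀ (firstFactor d (A i₀) k (settingIndex α 0))) -
        sqExp ρ (1 - tensor (bellFactor d A α k))) := by
    rw [bellValue, bellOperator, Matrix.sum_mul, Matrix.trace_sum, Complex.re_sum, Finset.mul_sum]
    refine Finset.sum_congr rfl fun α _ => ?_
    rw [Matrix.sum_mul, Matrix.trace_sum, Complex.re_sum, Finset.mul_sum]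
    refine Finset.sum_congr rfl fun k _ => ?_
    rw [two_mul_re_trace_mul hρ, sqExp_tensor_bellFactor (by omega) (by omega) hA hi₀]
  rw [h1, ← Finset.sum_add_distrib]
  simp only [← Finset.sum_add_distrib, sub_add_cancel]
  simp only [Finset.sum_add_distrib]
  congr 1
  · simp only [Finset.sum_const, Finset.card_univ, Nat.card_Icc, nsmul_eq_mul, mul_one,
      Fintype.card_fun, Fintype.card_fin, Nat.add_sub_cancel]
    rw [Nat.cast_pow, Nat.cast_sub (by omega : 1 ≤ d), Nat.cast_one]
  · rw [Finset.sum_comm, Finset.mul_sum]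
    refine Finset.sum_congr rfl fun k _ => ?_
    exact sum_setting_zero hN fun x => sqExp ρ (locHom n i₀ (firstFactor d (A i₀) k x))

lemma sum_firstFactor_le (hρ : IsState ρ) (hN : 2 ≤ N) (hd : 2 ≤ d) (hm : 2 ≤ m)
    (hA : ∀ i x, IsObservable d (A i x)) (i₀ : Fin N) :
    (m : ℝ) ^ (N - 2) * ∑ k ∈ Finset.Icc 1 (d - 1),
        ∑ x ∈ Finset.range m, sqExp ρ (locHom n i₀ (firstFactor d (A i₀) k x)) ≤
      (m : ℝ) ^ (N - 1) * (d - 1) := by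
  have h1 := Finset.sum_le_sum fun k (_ : k ∈ Finset.Icc 1 (d - 1)) =>
    (sum_sqExp_firstFactor hρ (by omega) hm hA i₀ k).1
  rw [Finset.sum_const, Nat.card_Icc, nsmul_eq_mul, Nat.sub_add_cancel (by omega : 1 ≤ d),
    Nat.cast_sub (by omega : 1 ≤ d), Nat.cast_one] at h1
  calc _ ≤ (m : ℝ) ^ (N - 2) * (((d : ℝ) - 1) * m) := by gcongr
    _ = (m : ℝ) ^ (N - 1) * (d - 1) := by
      rw [show N - 1 = N - 2 + 1 by omega, pow_succ]
      ring

theorem bellValue_le (hρ : IsState ρ) (hN : 2 ≤ N) (hd : 2 ≤ d) (hm : 2 ≤ m)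
    (hA : ∀ i x, IsObservable d (A i x)) : bellValue d A ρ ≤ (m : ℝ) ^ (N - 1) * (d - 1) := by
  have h1 := two_mul_bellValue_add hρ hN hd hm hA (i₀ := ⟨0, by omega⟩) rfl
  have h2 := sum_firstFactor_le hρ hN hd hm hA ⟨0, by omega⟩
  have h3 : 0 ≤ ∑ α : Fin (N - 1) → Fin m, ∑ k ∈ Finset.Icc 1 (d - 1),
      sqExp ρ (1 - tensor (bellFactor d A α k)) :=
    Finset.sum_nonneg fun _ _ => Finset.sum_nonneg fun _ _ => sqExp_nonneg hρ.1 _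
  linarith

/-- At the maximum the sum of squares is zero, hence so is each square. -/
lemma tensor_bellFactor_mul_of_max (hρ : IsState ρ) (hN : 2 ≤ N) (hd : 2 ≤ d) (hm : 2 ≤ m)
    (hA : ∀ i x, IsObservable d (A i x))
    (hmax : bellValue d A ρ = (m : ℝ) ^ (N - 1) * (d - 1)) (α : Fin (N - 1) → Fin m) {k : ℕ}
    (hk : k ∈ Finset.Icc 1 (d - 1)) : tensor (bellFactor d A α k) * ρ = ρ := by
  have h1 := two_mul_bellValue_add hρ hN hd hm hA (i₀ := ⟨0, by omega⟩) rfl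
  have h2 := sum_firstFactor_le hρ hN hd hm hA ⟨0, by omega⟩
  have h0 : ∀ α : Fin (N - 1) → Fin m, 0 ≤ ∑ k ∈ Finset.Icc 1 (d - 1),
      sqExp ρ (1 - tensor (bellFactor d A α k)) :=
    fun _ => Finset.sum_nonneg fun _ _ => sqExp_nonneg hρ.1 _
  have h3 : ∑ α : Fin (N - 1) → Fin m, ∑ k ∈ Finset.Icc 1 (d - 1),
      sqExp ρ (1 - tensor (bellFactor d A α k)) = 0 :=
    le_antisymm (by linarith) (Finset.sum_nonneg fun α _ => h0 α)
  have h4 := (Finset.sum_eq_zero_iff_of_nonneg fun α _ => h0 α).1 h3 α (Finset.mem_univ _)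
  have h5 := (Finset.sum_eq_zero_iff_of_nonneg fun _ _ => sqExp_nonneg hρ.1 _).1 h4 k hk
  have h6 := mul_eq_zero_of_sqExp_eq_zero hρ.1 h5
  rwa [Matrix.sub_mul, Matrix.one_mul, sub_eq_zero, eq_comm] at h6

/-- At the maximum the Wirtinger bound is tight for each k; k = 1 is enough, and full rank removes
ρ. -/
lemma phasedPow_recursion_of_max (hρ : IsState ρ) (hN : 2 ≤ N) (hd : 2 ≤ d) (hm : 2 ≤ m)
    (hA : ∀ i x, IsObservable d (A i x))
    (hmax : bellValue d A ρ = (m : ℝ) ^ (N - 1) * (d - 1)) {i₀ : Fin N} (hi₀ : (i₀ : ℕ) = 0)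
    (hrank : (reducedState ρ i₀).rank = Fintype.card (n i₀)) {x : ℕ} (hx : x + 2 ≤ m) :
    phasedPow d (A i₀) 1 (x + 2) = ((2 * Real.cos (Real.pi / m) : ℝ) : ℂ) •
      phasedPow d (A i₀) 1 (x + 1) - phasedPow d (A i₀) 1 x := by
  have h1 := two_mul_bellValue_add hρ hN hd hm hA hi₀
  have h3 : 0 ≤ ∑ α : Fin (N - 1) → Fin m, ∑ k ∈ Finset.Icc 1 (d - 1),
      sqExp ρ (1 - tensor (bellFactor d A α k)) :=
    Finset.sum_nonneg fun _ _ => Finset.sum_nonneg fun _ _ => sqExp_nonneg hρ.1 _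
  have hm0 : 0 < (m : ℝ) := by positivity
  have hle := fun k (_ : k ∈ Finset.Icc 1 (d - 1)) =>
    (sum_sqExp_firstFactor hρ (by omega) hm hA i₀ k).1
  have h4 : ∑ k ∈ Finset.Icc 1 (d - 1), (m : ℝ) = ∑ k ∈ Finset.Icc 1 (d - 1),
      ∑ x ∈ Finset.range m, sqExp ρ (locHom n i₀ (firstFactor d (A i₀) k x)) := by
    refine le_antisymm ?_ (Finset.sum_le_sum hle)
    rw [Finset.sum_const, Nat.card_Icc, nsmul_eq_mul, Nat.sub_add_cancel (by omega : 1 ≤ d),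
      Nat.cast_sub (by omega : 1 ≤ d), Nat.cast_one]
    apply le_of_mul_le_mul_left _ (pow_pos hm0 (N - 2))
    have h5 : (m : ℝ) ^ (N - 2) * (((d : ℝ) - 1) * m) = (m : ℝ) ^ (N - 1) * (d - 1) := by
      rw [show N - 1 = N - 2 + 1 by omega, pow_succ]
      ring
    linarith
  have h6 := (Finset.sum_eq_sum_iff_of_le hle).1 h4.symm 1 (by simp; omega)
  exact eq_of_locHom_mul_eq hrank ((sum_sqExp_firstFactor hρ (by omega) hm hA i₀ 1).2 h6 x hx)

/-- The structure of the observables of the first party at the maximal value. -/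
theorem firstParty_of_max (hρ : IsState ρ) (hN : 2 ≤ N) (hd : 2 ≤ d) (hm : 2 ≤ m)
    (hA : ∀ i x, IsObservable d (A i x))
    (hmax : bellValue d A ρ = (m : ℝ) ^ (N - 1) * (d - 1)) {i₀ : Fin N} (hi₀ : (i₀ : ℕ) = 0)
    (hrank : (reducedState ρ i₀).rank = Fintype.card (n i₀)) :
    ∃ P : Matrix (n i₀) (n i₀) ℂ, IsShift d (firstFactor d (A i₀) 1 0) P ∧
      (∀ x < m, firstFactor d (A i₀) 1 x = firstFactor d (A i₀) 1 0 * twist d (x / m) P) ∧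
      ∀ x : Fin m, A i₀ x = firstFactor d (A i₀) 1 0 * twist d (x / m - 1 / (2 * m)) P := by
  have hm' : 0 < m := by omega
  have hd' : d ≠ 0 := by omega
  set C : Matrix (n i₀) (n i₀) ℂ := firstFactor d (A i₀) 1 0 with hC
  set α : Fin (N - 1) → Fin m := fun _ => ⟨0, hm'⟩ with hα
  have hα0 : settingIndex α 0 = 0 := by rw [settingIndex_zero hN]
  set T := restTerm d A α with hT
  have hTobs : IsObservable d T := isObservable_restTerm hd' hm' hA α
  have hX : ∀ k ∈ Finset.Icc 1 (d - 1), T ^ k * (locHom n i₀ (firstFactor d (A i₀) k 0) * ρ) = ρ := by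
    intro k hk
    have := tensor_bellFactor_mul_of_max hρ hN hd hm hA hmax α hk
    rwa [tensor_bellFactor hi₀, hα0, Matrix.mul_assoc] at this
  have hX1 : T * locHom n i₀ C * ρ = ρ := by
    have := hX 1 (by simp; omega)
    rwa [pow_one, ← Matrix.mul_assoc] at this
  have hXk : ∀ k, T ^ k * (locHom n i₀ (C ^ k) * ρ) = ρ := by
    intro k
    have hcomm : Commute T (locHom n i₀ C) := restTerm_mul_locHom hi₀ α C
    rw [map_pow, ← Matrix.mul_assoc, ← hcomm.mul_pow]
    induction k with
    | zero => simp
    | succ k ih => rw [pow_succ, Matrix.mul_assoc, hX1, ih]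
  have hTcancel : ∀ (k : ℕ) (Y Z : Matrix (∀ i, n i) (∀ i, n i) ℂ), T ^ k * Y = T ^ k * Z → Y = Z := by
    intro k Y Z h
    have := congrArg (star T ^ k * ·) h
    simpa [← Matrix.mul_assoc, star_pow_mul_pow hTobs.star_mul_self] using this
  -- Both `hX` and `hXk` undo the same unitary `T ^ k` on ρ.
  have hCk : ∀ k, 1 ≤ k → k < d → firstFactor d (A i₀) k 0 = C ^ k := by
    intro k h1 h2
    apply eq_of_locHom_mul_eq hrank
    apply hTcancel k
    rw [hX k (Finset.mem_Icc.2 ⟨h1, by omega⟩), hXk]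
  have hCd : C ^ d = 1 := by
    apply eq_of_locHom_mul_eq hrank
    apply hTcancel d
    rw [hXk, hTobs.2, map_one, Matrix.one_mul, Matrix.one_mul]
  have hCstar : star C = C ^ (d - 1) := by
    rw [hC, star_firstFactor_one hd hm' (hA i₀), hCk (d - 1) (by omega) (by omega)]
  have hCu : star C * C = 1 := by
    rw [hCstar, ← pow_succ, Nat.sub_add_cancel (by omega), hCd]
  have hCu' : C * star C = 1 := by
    rw [hCstar, ← pow_succ', Nat.sub_add_cancel (by omega), hCd]
  have hobs := isObservable_extObs hd' hm' (hA i₀)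
  obtain ⟨P, hB, hCP, hshift⟩ := isShift_of_combination_pow hd' hm (hobs 0).star_mul_self
    (hobs 0).mul_star_self (hobs 1).star_mul_self (hobs 1).mul_star_self (hobs 0).2 (hobs 1).2
    (C := C) (by rw [hC, firstFactor, pow_one, pow_one, zero_add]) hCu hCu' hCd
    (fun k h1 h2 => by rw [← hCk k h1 h2, firstFactor, zero_add])
  have hPP : P * P = P := hshift.proj.isIdempotentElem.eq
  have hext : ∀ x ≤ m, extObs d (A i₀) x = extObs d (A i₀) 0 * twist d (x / m) P := by
    intro x
    induction x using Nat.twoStepInduction with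
    | zero => simp [twist_zero]
    | one => intro _; rw [hB, Nat.cast_one]
    | more x ih1 ih2 =>
      intro hx
      have hrec := phasedPow_recursion_of_max hρ hN hd hm hA hmax hi₀ hrank hx
      have h1 : ((2 * Real.cos (Real.pi / m) : ℝ) : ℂ) =
          omegaPow d (d / (2 * m)) + omegaPow d (-(d / (2 * m))) := by
        have := omegaPow_add_omegaPow_neg hd' (1 / (2 * m))
        rw [mul_one_div] at this
        rw [this]
        congr 3
        field_simp
      -- In antiperiodic normalisation the two phases of the twist are exp(±πix/m), which both solve
      -- the recursion.
      have h2 : ∀ x : ℕ, omegaPow d (-((2 * (1 : ℕ) - d) * x / (2 * m))) • twist d (x / m) P =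
          omegaPow d (x * (d / (2 * m))) • (1 - P) + omegaPow d (-(x * (d / (2 * m)))) • P := by
        intro x
        rw [twist, smul_add, smul_smul, smul_smul, ← omegaPow_add, ← omegaPow_add]
        congr 3 <;> (push_cast; field_simp; ring)
      have h3 : omegaPow d (-((2 * (1 : ℕ) - d) * (x + 2 : ℕ) / (2 * m))) • extObs d (A i₀) (x + 2) =
          omegaPow d (-((2 * (1 : ℕ) - d) * (x + 2 : ℕ) / (2 * m))) •
            (extObs d (A i₀) 0 * twist d ((x + 2 : ℕ) / m) P) := by
        simp only [phasedPow, pow_one] at hrec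
        rw [hrec, ih1 (by omega), ih2 (by omega), ← mul_smul_comm, ← mul_smul_comm, ← mul_smul_comm,
          h2, h2, h1, ← mul_smul_comm, h2, ← mul_sub]
        congr 1
        have e1 : ∀ r : ℝ, omegaPow d (((x + 1 : ℕ) : ℝ) * r) = omegaPow d (x * r) * omegaPow d r := by
          intro r
          rw [← omegaPow_add]; congr 1; push_cast; ring
        have e2 : ∀ r : ℝ, omegaPow d (((x + 2 : ℕ) : ℝ) * r) =
            omegaPow d (x * r) * omegaPow d r * omegaPow d r := by
          intro r
          rw [← omegaPow_add, ← omegaPow_add]; congr 1; push_cast; ring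
        simp only [← mul_neg, e1, e2]
        have hyy := omegaPow_mul_neg d (d / (2 * m))
        set y := omegaPow d (d / (2 * m))
        set y' := omegaPow d (-(d / (2 * m)))
        set w := omegaPow d (x * (d / (2 * m)))
        set w' := omegaPow d (x * -(d / (2 * m)))
        have f1 : w * y * y = (y + y') * (w * y) - w := by linear_combination -w * hyy
        have f2 : w' * y' * y' = (y + y') * (w' * y') - w' := by linear_combination -w' * hyy
        rw [f1, f2]
        module
      exact smul_right_injective _ (omegaPow_ne_zero _ _) h3
  have hA0 : extObs d (A i₀) 0 = C * twist d (-(1 / (2 * m))) P := by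
    rw [hCP, mul_assoc, twist_mul_neg d _ hPP, mul_one]
  refine ⟨P, hshift, ?_, ?_⟩
  · intro x hx
    rw [firstFactor, pow_one, pow_one, hext x hx.le, hext (x + 1) hx, ← mul_smul_comm,
      ← mul_smul_comm, ← mul_add, show (((x + 1 : ℕ) : ℝ) / m) = x / m + 1 / m by push_cast; ring,
      aCoeff_smul_twist hd' hm, hA0, mul_assoc, twist_mul_twist d _ _ hPP]
    congr 2
    ring
  · intro x
    rw [← extObs_of_lt (d := d) (A i₀) x.isLt, hext x x.isLt.le, hA0, mul_assoc,
      twist_mul_twist d _ _ hPP]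
    congr 2
    ring

end BellBound

end ASTA

namespace ASTA
open Matrix

set_option linter.unusedSectionVars false

/-! ### Passing the shift structure from party to party. -/

section Transfer

universe u

variable {N m d : ℕ} {n : Fin N → Type u} [∀ i, Fintype (n i)] [∀ i, DecidableEq (n i)]
  {A : ∀ i, Fin m → Matrix (n i) (n i) ℂ} {ρ : Matrix (∀ i, n i) (∀ i, n i) ℂ}

/-- The factor of a party with setting `q` in the Bell terms with `k = 1`. -/
noncomputable def partyFactor (d : ℕ) (A : ∀ i, Fin m → Matrix (n i) (n i) ℂ) (i : Fin N)
    (q : ℕ) : Matrix (n i) (n i) ℂ :=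
  if (i : ℕ) = 0 then firstFactor d (A i) 1 q
  else if Even (i : ℕ) then extObs d (A i) q else star (extObs d (A i) q)

lemma bellFactor_one_eq (α : Fin (N - 1) → Fin m) (i : Fin N) : bellFactor d A α 1 i =
    partyFactor d A i (if (i : ℕ) = 0 then settingIndex α 0
      else settingIndex α (i - 1) + settingIndex α i) := by
  rw [partyFactor]
  by_cases hi : (i : ℕ) = 0
  · rw [bellFactor_zero i hi, if_pos hi, if_pos hi]
  · rw [bellFactor, if_neg hi, if_neg hi, if_neg hi, pow_one, pow_one, star_eq_conjTranspose]

lemma isObservable_partyFactor (hd : d ≠ 0) (hm : 0 < m) (hA : ∀ i x, IsObservable d (A i x))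
    {i : Fin N} (hi : (i : ℕ) ≠ 0) (q : ℕ) : IsObservable d (partyFactor d A i q) := by
  rw [partyFactor, if_neg hi]
  split_ifs
  · exact isObservable_extObs hd hm (hA i) q
  · exact (isObservable_extObs hd hm (hA i) q).star

/-- The settings that vanish except for the one shared by the parties `i - 1` and `i`. -/
def singleSetting (hm : 0 < m) (i x : ℕ) (hx : x < m) : Fin (N - 1) → Fin m :=
  fun j => if (j : ℕ) + 1 = i then ⟨x, hx⟩ else ⟨0, hm⟩

lemma settingIndex_singleSetting (hm : 0 < m) {i x : ℕ} (hx : x < m) (hi : i < N) (j : ℕ) :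
    settingIndex (singleSetting (N := N) hm i x hx) j = if j + 1 = i then x else 0 := by
  rw [settingIndex]
  split_ifs with h1 h2 h2
  · simp [singleSetting, h2]
  · simp [singleSetting, h2]
  · omega
  · rfl

lemma bellFactor_singleSetting (hm : 0 < m) {i x : ℕ} (hx : x < m) (hi : i < N) (hi0 : 0 < i)
    (j : Fin N) : bellFactor d A (singleSetting hm i x hx) 1 j =
      partyFactor d A j (if (j : ℕ) + 1 = i ∨ (j : ℕ) = i then x else 0) := by
  rw [bellFactor_one_eq]
  simp only [settingIndex_singleSetting hm hx hi]
  congr 1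
  split_ifs <;> omega

/-- A product of local unitaries conjugates the operators of each party separately. -/
lemma star_tensor_pow_mul_locHom_mul {G : ∀ i, Matrix (n i) (n i) ℂ}
    (hG : ∀ i, star (G i) * G i = 1) (i : Fin N) (Y : Matrix (n i) (n i) ℂ) (j : ℕ) :
    star (tensor G) ^ j * locHom n i Y * tensor G ^ j =
      locHom n i (star (G i) ^ j * Y * G i ^ j) := by
  rw [star_eq_conjTranspose, conjTranspose_tensor, tensor_pow, tensor_pow, locHom_apply,
    locHom_apply, tensor_mul, tensor_mul]
  congr 1
  ext1 k
  by_cases hk : k = i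
  · subst hk
    simp [star_eq_conjTranspose]
  · rw [Function.update_of_ne hk, Function.update_of_ne hk, mul_one, ← star_eq_conjTranspose,
      star_pow_mul_pow (hG k)]

lemma locHom_shiftProj_mul {G : ∀ i, Matrix (n i) (n i) ℂ} (hG : ∀ i, star (G i) * G i = 1)
    (hGρ : tensor G * ρ = ρ) {i i₀ : Fin N} {P : Matrix (n i) (n i) ℂ}
    {P₀ : Matrix (n i₀) (n i₀) ℂ} (hP : locHom n i P * ρ = locHom n i₀ P₀ * ρ) (j : ℕ) :
    locHom n i (shiftProj (G i) P j) * ρ = locHom n i₀ (shiftProj (G i₀) P₀ j) * ρ := by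
  have hpow : tensor G ^ j * ρ = ρ := by
    induction j with
    | zero => simp
    | succ j ih => rw [pow_succ, Matrix.mul_assoc, hGρ, ih]
  rw [shiftProj, shiftProj, ← star_tensor_pow_mul_locHom_mul hG,
    ← star_tensor_pow_mul_locHom_mul hG, Matrix.mul_assoc, hpow, Matrix.mul_assoc, hP,
    Matrix.mul_assoc (_ * _), hpow, Matrix.mul_assoc]

lemma locHom_twist_mul {i i₀ : Fin N} {P : Matrix (n i) (n i) ℂ} {P₀ : Matrix (n i₀) (n i₀) ℂ}
    (hP : locHom n i P * ρ = locHom n i₀ P₀ * ρ) (r : ℝ) :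
    locHom n i (twist d r P) * ρ = locHom n i₀ (twist d r P₀) * ρ := by
  simp only [twist, map_add, map_smul, map_sub, map_one, Matrix.add_mul, Matrix.smul_mul,
    Matrix.sub_mul, hP]

/-- A party whose relative observables act on the state as the twists of a shift of party `i₀`
carries a shift of its own. -/
lemma exists_shift_of_transfer {i i₀ : Fin N} (hi : i₀ ≠ i)
    (hrank : (reducedState ρ i).rank = Fintype.card (n i))
    {G : ∀ i, Matrix (n i) (n i) ℂ} (hG : ∀ i, star (G i) * G i = 1) (hGρ : tensor G * ρ = ρ)
    (hGd : G i ^ d = 1) {P₀ : Matrix (n i₀) (n i₀) ℂ} (hP₀ : IsShift d (G i₀) P₀)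
    {r₁ : ℝ} (hr₁ : omegaPow d (-(d * r₁)) ≠ 1) {T₁ : Matrix (n i) (n i) ℂ}
    (hT₁ : star T₁ * T₁ = 1)
    (hT₁ρ : locHom n i T₁ * ρ = locHom n i₀ (twist d r₁ P₀) * ρ) :
    ∃ P : Matrix (n i) (n i) ℂ, IsShift d (G i) P ∧ locHom n i P * ρ = locHom n i₀ P₀ * ρ := by
  have hPP₀ : P₀ * P₀ = P₀ := hP₀.proj.isIdempotentElem.eq
  have hPs₀ : star P₀ = P₀ := hP₀.proj.isSelfAdjoint.star_eq
  have hcomm : ∀ (X : Matrix (n i) (n i) ℂ) (Y : Matrix (n i₀) (n i₀) ℂ),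
      locHom n i X * (locHom n i₀ Y * ρ) = locHom n i₀ Y * (locHom n i X * ρ) := by
    intro X Y
    rw [← Matrix.mul_assoc, ← locHom_commute hi, Matrix.mul_assoc]
  set c : ℂ := omegaPow d (r₁ - d * r₁) - omegaPow d r₁ with hc
  have hc0 : c ≠ 0 := by
    intro h
    rw [hc, sub_eq_add_neg r₁, omegaPow_add, ← mul_sub_one] at h
    exact hr₁ (sub_eq_zero.1 ((mul_eq_zero.1 h).resolve_left (omegaPow_ne_zero _ _)))
  have htw : twist d r₁ P₀ = omegaPow d r₁ • 1 + c • P₀ := by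
    rw [twist, hc]
    module
  have htw' : twist d (-r₁) P₀ = star (omegaPow d r₁) • 1 + star c • P₀ := by
    rw [← star_twist d r₁ hPs₀, htw, star_add, star_smul, star_smul, star_one, hPs₀]
  set P : Matrix (n i) (n i) ℂ := c⁻¹ • (T₁ - omegaPow d r₁ • 1) with hP
  -- Operators of different parties commute, so the inverse of `T₁` acts on ρ as the inverse twist;
  -- this is needed for `P` to be self-adjoint.
  have hT₁s : locHom n i (star T₁) * ρ = locHom n i₀ (twist d (-r₁) P₀) * ρ := by
    have h1 : locHom n i (star T₁) * (locHom n i₀ (twist d r₁ P₀) * ρ) = ρ := by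
      rw [← hT₁ρ, ← Matrix.mul_assoc, ← map_mul, hT₁, map_one, Matrix.one_mul]
    rw [hcomm] at h1
    have h2 := congrArg (locHom n i₀ (twist d (-r₁) P₀) * ·) h1
    simp only [← Matrix.mul_assoc, ← map_mul, twist_neg_mul d r₁ hPP₀, map_one,
      Matrix.one_mul] at h2
    exact h2
  have hPρ : locHom n i P * ρ = locHom n i₀ P₀ * ρ := by
    rw [hP, map_smul, map_sub, map_smul, map_one, Matrix.smul_mul, Matrix.sub_mul, hT₁ρ, htw,
      map_add, map_smul, map_smul, map_one, Matrix.add_mul, add_sub_cancel_left, Matrix.smul_mul,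
      smul_smul, inv_mul_cancel₀ hc0, one_smul]
  have hPsρ : locHom n i (star P) * ρ = locHom n i₀ P₀ * ρ := by
    rw [hP, star_smul, star_sub, star_smul, star_one, star_inv₀, map_smul, map_sub, map_smul,
      map_one, Matrix.smul_mul, Matrix.sub_mul, hT₁s, htw', map_add, map_smul, map_smul, map_one,
      Matrix.add_mul, add_sub_cancel_left, Matrix.smul_mul, smul_smul,
      inv_mul_cancel₀ (star_ne_zero.2 hc0), one_smul]
  -- Transfer across ρ reverses the order of products.
  have hmul : ∀ {X X' : Matrix (n i) (n i) ℂ} {Y Y' : Matrix (n i₀) (n i₀) ℂ},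
      locHom n i X * ρ = locHom n i₀ Y * ρ → locHom n i X' * ρ = locHom n i₀ Y' * ρ →
      locHom n i (X * X') * ρ = locHom n i₀ (Y' * Y) * ρ := by
    intro X X' Y Y' h h'
    rw [map_mul, Matrix.mul_assoc, h', hcomm, h, ← Matrix.mul_assoc, ← map_mul]
  have hproj : IsStarProjection P := by
    refine ⟨eq_of_locHom_mul_eq hrank ?_, eq_of_locHom_mul_eq hrank (hPsρ.trans hPρ.symm)⟩
    rw [hmul hPρ hPρ, hPP₀, hPρ]
  have hQ := locHom_shiftProj_mul hG hGρ hPρ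
  refine ⟨P, ⟨hG i, mul_eq_one_comm.1 (hG i), hGd, hproj, ?_, ?_⟩, hPρ⟩
  · intro j hj k hk hjk
    apply eq_of_locHom_mul_eq hrank
    rw [hmul (hQ j) (hQ k), hP₀.orthogonal k hk j hj hjk.symm]
    simp
  · apply eq_of_locHom_mul_eq hrank
    rw [map_sum, Matrix.sum_mul, Finset.sum_congr rfl fun j _ => hQ j, ← Matrix.sum_mul, ← map_sum,
      hP₀.sum_eq_one, map_one, map_one]

/-- The structure of all the parties at the maximal value. -/
theorem exists_shift_of_max (hρ : IsState ρ) (hN : 2 ≤ N) (hd : 2 ≤ d) (hm : 2 ≤ m)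
    (hA : ∀ i x, IsObservable d (A i x))
    (hmax : bellValue d A ρ = (m : ℝ) ^ (N - 1) * (d - 1))
    (hrank : ∀ i, (reducedState ρ i).rank = Fintype.card (n i))
    {i₀ : Fin N} (hi₀ : (i₀ : ℕ) = 0) :
    tensor (fun i => partyFactor d A i 0) * ρ = ρ ∧
    ∃ P : ∀ i, Matrix (n i) (n i) ℂ, ∀ i, IsShift d (partyFactor d A i 0) (P i) ∧
      locHom n i (P i) * ρ = locHom n i₀ (P i₀) * ρ ∧
      ∀ x : Fin m, (if (i : ℕ) = 0 then A i x else if Even (i : ℕ) then A i x else star (A i x)) =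
        partyFactor d A i 0 * twist d ((if (i : ℕ) = 0 then x / m - 1 / (2 * m)
          else if Even (i : ℕ) then x / m else -(x / m))) (P i) := by
  have hm' : 0 < m := by omega
  have hd' : d ≠ 0 := by omega
  obtain ⟨P₀, hshift₀, hC, hA₀⟩ := firstParty_of_max hρ hN hd hm hA hmax hi₀ (hrank i₀)
  have hpf₀ : ∀ q, partyFactor d A i₀ q = firstFactor d (A i₀) 1 q := by
    intro q
    rw [partyFactor, if_pos hi₀]
  set G : ∀ i, Matrix (n i) (n i) ℂ := fun i => partyFactor d A i 0 with hGdef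
  have hG : ∀ i, star (G i) * G i = 1 := by
    intro i
    by_cases hi : i = i₀
    · subst hi
      simp only [hGdef, hpf₀]
      exact hshift₀.star_mul_self
    · exact (isObservable_partyFactor hd' hm' hA
        (fun h => hi (Fin.ext (h.trans hi₀.symm))) 0).star_mul_self
  have hX : ∀ (i x : ℕ) (hx : x < m), i < N → 0 < i →
      tensor (fun j => partyFactor d A j (if (j : ℕ) + 1 = i ∨ (j : ℕ) = i then x else 0)) * ρ =
        ρ := by
    intro i x hx hi hi0
    have h := tensor_bellFactor_mul_of_max hρ hN hd hm hA hmax (singleSetting hm' i x hx)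
      (k := 1) (by simp; omega)
    have e : bellFactor d A (singleSetting hm' i x hx) 1 = fun j =>
        partyFactor d A j (if (j : ℕ) + 1 = i ∨ (j : ℕ) = i then x else 0) :=
      funext fun j => bellFactor_singleSetting hm' hx hi hi0 j
    rwa [e] at h
  have hGρ : tensor G * ρ = ρ := by
    have := hX 1 0 hm' (by omega) one_pos
    simpa using this
  have hGρ' : star (tensor G) * ρ = ρ := by
    have h1 : star (tensor G) * tensor G = 1 := by
      rw [star_eq_conjTranspose, conjTranspose_tensor, tensor_mul, ← tensor_one]
      congr 1
      ext1 i
      exact hG i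
    calc star (tensor G) * ρ = star (tensor G) * (tensor G * ρ) := by rw [hGρ]
      _ = ρ := by rw [← Matrix.mul_assoc, h1, Matrix.one_mul]
  refine ⟨hGρ, ?_⟩
  have hshiftG₀ : IsShift d (G i₀) P₀ := by
    simp only [hGdef, hpf₀]
    exact hshift₀
  -- Each neighbour carries the inverse twist, hence the alternating sign. Party 0 has a clause of
  -- its own because its factor is a combination of observables, half a step away from `A i x`.
  have key : ∀ (k : ℕ) (i : Fin N), (i : ℕ) = k → ∃ P : Matrix (n i) (n i) ℂ,
      IsShift d (G i) P ∧ locHom n i P * ρ = locHom n i₀ P₀ * ρ ∧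
      (∀ x < m, partyFactor d A i x = G i * twist d ((-1) ^ k * (x / m)) P) ∧
      (k = 0 → ∀ x : Fin m, A i x = G i * twist d (x / m - 1 / (2 * m)) P) := by
    intro k
    induction k with
    | zero =>
      intro i hi
      obtain rfl : i₀ = i := Fin.ext (hi₀.trans hi.symm)
      refine ⟨P₀, hshiftG₀, rfl, fun x hx => ?_, fun _ x => ?_⟩
      · simp only [hGdef, hpf₀, pow_zero, one_mul]
        exact hC x hx
      · simp only [hGdef, hpf₀]
        exact hA₀ x
    | succ k ih =>
      intro i hi
      have hk : k + 1 < N := hi ▸ i.isLt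
      obtain ⟨i', hi'⟩ : ∃ i' : Fin N, (i' : ℕ) = k := ⟨⟨k, by omega⟩, rfl⟩
      obtain ⟨P', hs', hP', hx', -⟩ := ih i' hi'
      have hii' : i' ≠ i := by
        rintro rfl
        omega
      have hi0 : i₀ ≠ i := by
        rintro rfl
        omega
      have hobs : ∀ q, IsObservable d (partyFactor d A i q) :=
        isObservable_partyFactor hd' hm' hA (by omega)
      have hPP' : P' * P' = P' := hs'.proj.isIdempotentElem.eq
      -- Compare the term with one shared setting x to the term with all settings 0: only `i'` and
      -- `i` differ, and the twist of `i'` is known.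
      have hT : ∀ x < m, locHom n i (star (G i) * partyFactor d A i x) * ρ =
          locHom n i₀ (twist d ((-1) ^ (k + 1) * (x / m)) P₀) * ρ := by
        intro x hx
        have h1 : star (tensor G) * tensor (fun j => partyFactor d A j
            (if (j : ℕ) + 1 = k + 1 ∨ (j : ℕ) = k + 1 then x else 0)) =
            locHom n i' (star (G i') * partyFactor d A i' x) *
              locHom n i (star (G i) * partyFactor d A i x) := by
          rw [star_eq_conjTranspose, conjTranspose_tensor, tensor_mul, locHom_mul_locHom hii']
          congr 1
          ext1 j
          by_cases hj : j = i
          · subst hj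
            rw [Function.update_self, if_pos (Or.inr hi), star_eq_conjTranspose]
          · rw [Function.update_of_ne hj]
            by_cases hj' : j = i'
            · subst hj'
              rw [Function.update_self, if_pos (Or.inl (by omega)), star_eq_conjTranspose]
            · rw [Function.update_of_ne hj', if_neg]
              · exact hG j
              · rintro (h | h)
                · exact hj' (Fin.ext (by omega))
                · exact hj (Fin.ext (h.trans hi.symm))
        have h2 := congrArg (· * ρ) h1
        simp only [Matrix.mul_assoc, hX (k + 1) x hx hk (by omega), hGρ'] at h2
        rw [hx' x hx, ← mul_assoc (star (G i')), hG i', one_mul] at h2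
        have h3 := congrArg (locHom n i' (twist d (-((-1) ^ k * (x / m))) P') * ·) h2
        simp only [← Matrix.mul_assoc (locHom n i' _), ← map_mul, twist_neg_mul d _ hPP', map_one,
          Matrix.one_mul] at h3
        rw [← h3, locHom_twist_mul hP', pow_succ]
        congr 3
        ring
      have hr₁ : omegaPow d (-(d * ((-1) ^ (k + 1) * ((1 : ℕ) / m)))) ≠ 1 := by
        have h1 := omegaPow_dim_mul_ne_one hd' (r := (1 : ℕ) / m) (by positivity)
          ((div_lt_one (by positivity)).2 (by exact_mod_cast hm))
        have h2 := omegaPow_mul_neg d (d * ((1 : ℕ) / m))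
        rcases neg_one_pow_eq_or ℝ (k + 1) with h | h
        · rw [h, one_mul]
          intro h3
          rw [h3, mul_one] at h2
          exact h1 h2
        · rw [h, neg_one_mul, mul_neg, neg_neg]
          exact h1
      -- Setting 1, available since m ≥ 2, already determines `P`; the other settings then follow
      -- from `hT`.
      obtain ⟨P, hs, hP⟩ := exists_shift_of_transfer hi0 (hrank i) hG hGρ (hobs 0).2 hshiftG₀
        hr₁ (by
          rw [star_mul, star_star, mul_assoc, ← mul_assoc (G i), (hobs 0).mul_star_self, one_mul,
            (hobs _).star_mul_self]) (hT 1 (by omega))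
      refine ⟨P, hs, hP, fun x hx => ?_, fun h => absurd h (by omega)⟩
      have h1 := eq_of_locHom_mul_eq (hrank i) ((hT x hx).trans (locHom_twist_mul hP _).symm)
      rw [← h1, ← mul_assoc, (hobs 0).mul_star_self, one_mul]
  choose P hs hP hx hx0 using fun i : Fin N => key i i rfl
  refine ⟨P, fun i => ⟨hs i, ?_, ?_⟩⟩
  · rw [hP i, hP i₀]
  · intro x
    by_cases hi : (i : ℕ) = 0
    · rw [if_pos hi, if_pos hi]
      exact hx0 i hi x
    · have h1 := hx i x x.isLt
      rw [partyFactor, if_neg hi, extObs_of_lt _ x.isLt] at h1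
      rw [if_neg hi, if_neg hi]
      by_cases he : Even (i : ℕ)
      · rw [if_pos he, if_pos he]
        rw [if_pos he, he.neg_one_pow, one_mul] at h1
        exact h1
      · rw [if_neg he, if_neg he]
        rw [if_neg he, (Nat.not_even_iff_odd.1 he).neg_one_pow, neg_one_mul] at h1
        exact h1

end Transfer

end ASTA

namespace ASTA
open Matrix

set_option linter.unusedSectionVars false

/-! ### Local normal form with prescribed phases. -/

section LocalForm

variable {n : Type*} [Fintype n] [DecidableEq n]

lemma twist_kronecker_one {d D : ℕ} (r : ℝ) (E : Matrix (Fin d) (Fin d) ℂ) :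
    twist d r (E ⊗ₖ (1 : Matrix (Fin D) (Fin D) ℂ)) = twist d r E ⊗ₖ 1 := by
  ext p q
  rw [twist, ← one_kronecker_one]
  simp only [twist, Matrix.add_apply, Matrix.smul_apply, Matrix.sub_apply, kroneckerMap_apply,
    smul_eq_mul]
  ring

lemma phase_mul_firstProj (d : ℕ) (r : ℝ) :
    phase d r * firstProj d * phase d (-r) = firstProj d := by
  rw [phase, phase, firstProj, diagonal_mul_diagonal, diagonal_mul_diagonal]
  congr 1
  ext j
  split_ifs with h
  · simp [h, omegaPow_zero]
  · simp

/-- A shift is unitarily equivalent to an ideal one, with any prescribed phases. -/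
lemma IsShift.exists_unitary_phase {d : ℕ} {S P : Matrix n n ℂ} (h : IsShift d S P) (τ : ℝ) :
    ∃ (D : ℕ) (e : n ≃ Fin d × Fin D) (U : Matrix n n ℂ), U ∈ Matrix.unitaryGroup n ℂ ∧
      (∀ r : ℝ, Matrix.reindex e e (U * (S * twist d r P) * Uᴴ) =
        lowerPhase d (r - τ) ⊗ₖ (1 : Matrix (Fin D) (Fin D) ℂ)) ∧
      Matrix.reindex e e (U * P * Uᴴ) = firstProj d ⊗ₖ (1 : Matrix (Fin D) (Fin D) ℂ) := by
  obtain ⟨D, e, U, hU, hS, hP⟩ := h.exists_unitary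
  have hUU : Uᴴ * U = 1 := Matrix.mem_unitaryGroup_iff'.1 hU
  have hUU' : U * Uᴴ = 1 := Matrix.mem_unitaryGroup_iff.1 hU
  let φ := Matrix.reindexAlgEquiv ℂ ℂ e
  -- Conjugation by this diagonal unitary moves all phases by -τ and leaves the first basis
  -- projection fixed.
  set K : Matrix (Fin d × Fin D) (Fin d × Fin D) ℂ := phase d τ ⊗ₖ 1 with hK
  have hKs : Kᴴ = phase d (-τ) ⊗ₖ 1 := by
    rw [hK, conjTranspose_kronecker, conjTranspose_phase, conjTranspose_one]
  have hKK : K * Kᴴ = 1 := by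
    rw [hKs, hK, ← mul_kronecker_mul, phase_mul_phase, add_neg_cancel, phase_zero, Matrix.one_mul,
      one_kronecker_one]
  have hφs' : ∀ X, φ.symm (Xᴴ) = (φ.symm X)ᴴ := fun X => rfl
  change φ _ = _ at hS hP
  have hconj : ∀ X, φ (φ.symm K * U * X * (φ.symm K * U)ᴴ) = K * φ (U * X * Uᴴ) * Kᴴ := by
    intro X
    rw [conjTranspose_mul, ← hφs']
    simp only [map_mul, AlgEquiv.apply_symm_apply, Matrix.mul_assoc]
  refine ⟨D, e, φ.symm K * U, ?_, fun r => ?_, ?_⟩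
  · rw [Matrix.mem_unitaryGroup_iff, star_eq_conjTranspose, conjTranspose_mul, Matrix.mul_assoc,
      ← Matrix.mul_assoc U, hUU', Matrix.one_mul, ← hφs', ← map_mul, hKK, map_one]
  · change φ _ = _
    have h1 : U * (S * twist d r P) * Uᴴ = (U * S * Uᴴ) * twist d r (U * P * Uᴴ) := by
      have h2 : twist d r (U * P * Uᴴ) = U * twist d r P * Uᴴ := by
        simp only [twist, Matrix.mul_add, Matrix.mul_sub, Matrix.add_mul, Matrix.sub_mul,
          Matrix.mul_smul, Matrix.smul_mul, Matrix.mul_one, hUU']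
      rw [h2]
      calc U * (S * twist d r P) * Uᴴ = U * S * 1 * twist d r P * Uᴴ := by
            rw [Matrix.mul_one, Matrix.mul_assoc U S]
        _ = _ := by rw [← hUU]; simp only [Matrix.mul_assoc]
    have h2 : φ (twist d r (U * P * Uᴴ)) = twist d r (φ (U * P * Uᴴ)) := by
      simp only [twist, map_add, map_smul, map_sub, map_one]
    rw [hconj, h1, map_mul, h2, hS, hP, twist_kronecker_one, ← mul_kronecker_mul, lower_mul_twist,
      hKs, hK, ← mul_kronecker_mul, ← mul_kronecker_mul, Matrix.mul_one, Matrix.mul_one]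
    congr 1
    · have := phase_conj_lowerPhase d r (-τ)
      rwa [neg_neg] at this
    · exact Matrix.mul_one 1
  · change φ _ = _
    rw [hconj, hP, hKs, hK, ← mul_kronecker_mul, ← mul_kronecker_mul, Matrix.one_mul,
      Matrix.one_mul, phase_mul_firstProj]

end LocalForm

/-! ### Characterisation of the GHZ state. -/

section GHZ

lemma ghz_apply {N d : ℕ} (hN : 0 < N) (a : Fin N → Fin d) (j : Fin d) (hj : a ⟨0, hN⟩ = j) :
    ghz N d a = if ∀ i, a i = j then ((1 / Real.sqrt d : ℝ) : ℂ) else 0 := by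
  have h1 : ∑ k : Fin d, ∏ i, (if a i = k then (1 : ℂ) else 0) =
      if ∀ i, a i = j then 1 else 0 := by
    rw [Finset.sum_eq_single j]
    · rw [Finset.prod_ite_zero]
      simp
    · intro k _ hk
      exact Finset.prod_eq_zero (Finset.mem_univ ⟨0, hN⟩) (if_neg fun h => hk (h.symm.trans hj))
    · simp
  rw [ghz, h1, mul_ite, mul_one, mul_zero]

lemma ghzState_apply {N d : ℕ} (a b : Fin N → Fin d) :
    ghzState N d a b = ghz N d a * star (ghz N d b) := rfl

lemma one_div_sqrt_mul_self (d : ℕ) :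
    ((1 / Real.sqrt d : ℝ) : ℂ) * star ((1 / Real.sqrt d : ℝ) : ℂ) = 1 / d := by
  rw [Complex.star_def, Complex.conj_ofReal, ← Complex.ofReal_mul, div_mul_div_comm,
    Real.mul_self_sqrt (Nat.cast_nonneg d)]
  simp

lemma trace_ghzState {N d : ℕ} (hN : 0 < N) (hd : d ≠ 0) : (ghzState N d).trace = 1 := by
  have hd' : (d : ℂ) ≠ 0 := by exact_mod_cast hd
  rw [Matrix.trace]
  have h1 : ∀ a : Fin N → Fin d, (ghzState N d).diag a =
      ∑ j : Fin d, if a = fun _ => j then (1 / d : ℂ) else 0 := by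
    intro a
    rw [diag_apply, ghzState_apply, ghz_apply hN a _ rfl,
      Finset.sum_eq_single (a ⟨0, hN⟩)]
    · simp only [funext_iff]
      split_ifs
      · exact one_div_sqrt_mul_self d
      · simp
    · intro j _ hj
      rw [if_neg]
      intro h
      exact hj (congrFun h _).symm
    · simp
  rw [Finset.sum_congr rfl fun a _ => h1 a, Finset.sum_comm]
  simp [hd']

lemma isState_ghzState {N d : ℕ} (hN : 0 < N) (hd : d ≠ 0) : IsState (ghzState N d) :=
  ⟨Matrix.posSemidef_vecMulVec_self_star _, trace_ghzState hN hd⟩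

/-- A Hermitian operator that is invariant under the product of the (phased) shifts and on which
the projections on the first basis vector of all parties agree is a multiple of the GHZ projector
on the first tensor factor. -/
lemma omegaPow_sum (d : ℕ) {ι : Type*} (s : Finset ι) (f : ι → ℝ) :
    omegaPow d (∑ i ∈ s, f i) = ∏ i ∈ s, omegaPow d (f i) := by
  classical
  induction s using Finset.induction_on with
  | empty => simp [omegaPow_zero]
  | insert i s hi ih => rw [Finset.prod_insert hi, Finset.sum_insert hi, omegaPow_add, ih]

/-- A nonzero row has either all parties at 0 or none; shifting until the first party is at 0 shows
that all its indices agree. Between constant rows the phases multiply to 1, as the τ sum to zero.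
Hermiticity gives the same for columns. -/
lemma eq_ghzState_mul {N d : ℕ} {D : Fin N → ℕ} (hN : 0 < N) (τ : Fin N → ℝ) (hτ : ∑ i, τ i = 0)
    (r : (Fin N → Fin d) → (∀ i, Fin (D i)) → (Fin N → Fin d) → (∀ i, Fin (D i)) → ℂ)
    (hherm : ∀ a s b t, r b t a s = star (r a s b t))
    (hproj : ∀ a s b t i, r a s b t ≠ 0 → ((a i : ℕ) = 0 ↔ (a ⟨0, hN⟩ : ℕ) = 0))
    (hshift : ∀ (a a' : Fin N → Fin d), (∀ i, (a' i : ℕ) = (a i + 1) % d) → ∀ s b t,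
      r a s b t = (∏ i, omegaPow d (((a' i : ℝ) - a i) * τ i)) * r a' s b t)
    (z : Fin d) (hz : (z : ℕ) = 0) (a : Fin N → Fin d) (s : ∀ i, Fin (D i)) (b : Fin N → Fin d)
    (t : ∀ i, Fin (D i)) :
    r a s b t = ghzState N d a b * (d * r (fun _ => z) s (fun _ => z) t) := by
  have hd : 0 < d := z.pos
  -- Induction on the number of shifts that bring the first party to 0.
  have hconst : ∀ (k : ℕ) (a : Fin N → Fin d), ((a ⟨0, hN⟩ : ℕ) + k) % d = 0 → ∀ s b t,
      r a s b t ≠ 0 → ∀ i, a i = a ⟨0, hN⟩ := by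
    intro k
    induction k with
    | zero =>
      intro a h0 s b t hr i
      rw [add_zero, Nat.mod_eq_of_lt (Fin.isLt _)] at h0
      exact Fin.ext (((hproj a s b t i hr).2 h0).trans h0.symm)
    | succ k ih =>
      intro a h0 s b t hr i
      set a' : Fin N → Fin d := fun i => ⟨((a i : ℕ) + 1) % d, Nat.mod_lt _ hd⟩ with ha'
      have h1 := hshift a a' (fun i => rfl) s b t
      have h2 : r a' s b t ≠ 0 := by
        intro h
        rw [h, mul_zero] at h1
        exact hr h1
      have h3 := ih a' (by
        simpa only [ha', Nat.mod_add_mod, add_assoc, add_comm 1] using h0) s b t h2 i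
      have h4 : ((a i : ℕ) + 1) % d = ((a ⟨0, hN⟩ : ℕ) + 1) % d := congrArg Fin.val h3
      have h5 : (a i : ℕ) ≡ (a ⟨0, hN⟩ : ℕ) [MOD d] := Nat.ModEq.add_right_cancel' 1 h4
      exact Fin.ext (h5.eq_of_lt_of_lt (Fin.isLt _) (Fin.isLt _))
  have hcol : ∀ (j : ℕ) (hj : j < d) (s b t), r (fun _ => ⟨j, hj⟩) s b t = r (fun _ => z) s b t := by
    intro j
    induction j with
    | zero =>
      intro hj s b t
      rw [show z = ⟨0, hj⟩ from Fin.ext hz]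
    | succ j ih =>
      intro hj s b t
      rw [← ih (by omega) s b t, hshift (fun _ => ⟨j, by omega⟩) (fun _ => ⟨j + 1, hj⟩)
        (fun i => (Nat.mod_eq_of_lt hj).symm) s b t]
      rw [Finset.prod_congr rfl (g := fun i => omegaPow d (τ i))]
      · rw [← omegaPow_sum, hτ, omegaPow_zero, one_mul]
      · intro i _
        congr 1
        push_cast
        ring
  have hrow : ∀ (a : Fin N → Fin d) (s b t), r a s b t =
      if ∀ i, a i = a ⟨0, hN⟩ then r (fun _ => z) s b t else 0 := by
    intro a s b t
    split_ifs with h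
    · rw [← hcol (a ⟨0, hN⟩) (Fin.isLt _)]
      congr 1
      exact funext h
    · by_contra hr
      refine h (hconst (d - a ⟨0, hN⟩) a ?_ s b t hr)
      rw [Nat.add_sub_cancel' (Fin.isLt _).le, Nat.mod_self]
  rw [ghzState_apply, ghz_apply hN a _ rfl, ghz_apply hN b _ rfl, hrow a s b t]
  split_ifs with ha hb hb
  · have hb' : b = fun _ => b ⟨0, hN⟩ := funext hb
    rw [one_div_sqrt_mul_self, hb', hherm (fun _ => b ⟨0, hN⟩) t (fun _ => z) s,
      hcol (b ⟨0, hN⟩) (Fin.isLt _), ← hherm (fun _ => z) t (fun _ => z) s]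
    field_simp
  · rw [hherm b t (fun _ => z) s, hrow b t, if_neg hb]
    simp
  · simp
  · simp

end GHZ

/-! ### The state in the local normal form. -/

section Rigidity

universe u

variable {N m d : ℕ} {n : Fin N → Type u} [∀ i, Fintype (n i)] [∀ i, DecidableEq (n i)]

/-- Separation of the ideal and the auxiliary factors of all parties. -/
def splitEquiv {D : Fin N → ℕ} (e : ∀ i, n i ≃ Fin d × Fin (D i)) :
    (∀ i, n i) ≃ (Fin N → Fin d) × (∀ i, Fin (D i)) where
  toFun x := (fun i => (e i (x i)).1, fun i => (e i (x i)).2)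
  invFun p := fun i => (e i).symm (p.1 i, p.2 i)
  left_inv x := by ext1 i; simp
  right_inv p := by simp

theorem exists_unitary_of_shifts (hN : 2 ≤ N) (hd : 2 ≤ d) {ρ : Matrix (∀ i, n i) (∀ i, n i) ℂ}
    (hρ : IsState ρ) {S P : ∀ i, Matrix (n i) (n i) ℂ} (hS : ∀ i, IsShift d (S i) (P i))
    (hSρ : tensor S * ρ = ρ) {i₀ : Fin N} (hi₀ : (i₀ : ℕ) = 0)
    (hPρ : ∀ i, locHom n i (P i) * ρ = locHom n i₀ (P i₀) * ρ)
    (τ : Fin N → ℝ) (hτ : ∑ i, τ i = 0) :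
    ∃ (D : Fin N → ℕ) (e : ∀ i, n i ≃ Fin d × Fin (D i)) (U : ∀ i, Matrix (n i) (n i) ℂ)
      (σ : Matrix (∀ i, Fin (D i)) (∀ i, Fin (D i)) ℂ),
      (∀ i, U i ∈ Matrix.unitaryGroup (n i) ℂ) ∧ IsState σ ∧
      (∀ x y : ∀ i, n i, (tensor U * ρ * (tensor U)ᴴ) x y =
        ghzState N d (fun i => (e i (x i)).1) (fun i => (e i (y i)).1) *
          σ (fun i => (e i (x i)).2) (fun i => (e i (y i)).2)) ∧
      ∀ i (r : ℝ), Matrix.reindex (e i) (e i) (U i * (S i * twist d r (P i)) * (U i)ᴴ) =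
        lowerPhase d (r - τ i) ⊗ₖ (1 : Matrix (Fin (D i)) (Fin (D i)) ℂ) := by
  have hN0 : 0 < N := by omega
  obtain rfl : i₀ = ⟨0, hN0⟩ := Fin.ext hi₀
  choose D e U hU hform hproj using fun i => (hS i).exists_unitary_phase (τ i)
  have hUU : (tensor U)ᴴ * tensor U = 1 := by
    rw [conjTranspose_tensor, tensor_mul, ← tensor_one]
    congr 1
    ext1 i
    exact Matrix.mem_unitaryGroup_iff'.1 (hU i)
  set ρ' : Matrix (∀ i, n i) (∀ i, n i) ℂ := tensor U * ρ * (tensor U)ᴴ with hρ'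
  have hpsd : ρ'.PosSemidef := hρ.1.mul_mul_conjTranspose_same _
  have htr : ρ'.trace = 1 := by
    rw [hρ', Matrix.trace_mul_comm, ← Matrix.mul_assoc, hUU, Matrix.one_mul, hρ.2]
  have hconj : ∀ X : Matrix (∀ i, n i) (∀ i, n i) ℂ,
      (tensor U * X * (tensor U)ᴴ) * ρ' = tensor U * (X * ρ) * (tensor U)ᴴ := by
    intro X
    rw [hρ']
    simp only [Matrix.mul_assoc]
    rw [← Matrix.mul_assoc (tensor U)ᴴ, hUU, Matrix.one_mul]
  have hS' : tensor (fun i => U i * S i * (U i)ᴴ) * ρ' = ρ' := by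
    have h1 : tensor (fun i => U i * S i * (U i)ᴴ) = tensor U * tensor S * (tensor U)ᴴ := by
      rw [conjTranspose_tensor, tensor_mul, tensor_mul]
    rw [h1, hconj, hSρ]
  have hloc : ∀ i (X : Matrix (n i) (n i) ℂ),
      tensor U * locHom n i X * (tensor U)ᴴ = locHom n i (U i * X * (U i)ᴴ) := by
    intro i X
    rw [conjTranspose_tensor, locHom_apply, locHom_apply, tensor_mul, tensor_mul]
    congr 1
    ext1 j
    by_cases hj : j = i
    · subst hj
      simp
    · rw [Function.update_of_ne hj, Function.update_of_ne hj, mul_one]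
      exact Matrix.mem_unitaryGroup_iff.1 (hU j)
  have hP' : ∀ i, locHom n i (U i * P i * (U i)ᴴ) * ρ' =
      locHom n ⟨0, hN0⟩ (U ⟨0, hN0⟩ * P ⟨0, hN0⟩ * (U ⟨0, hN0⟩)ᴴ) * ρ' := by
    intro i
    rw [← hloc, ← hloc, hconj, hconj, hPρ i]
  have hProw : ∀ i x y, (locHom n i (U i * P i * (U i)ᴴ) * ρ') x y =
      if ((e i (x i)).1 : ℕ) = 0 then ρ' x y else 0 := by
    intro i x y
    have h1 : U i * P i * (U i)ᴴ =
        diagonal fun c : n i => if ((e i c).1 : ℕ) = 0 then (1 : ℂ) else 0 := by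
      apply (Matrix.reindex (e i) (e i)).injective
      rw [hproj i]
      ext p q
      rw [kroneckerMap_apply, firstProj, reindex_apply, submatrix_apply, diagonal_apply,
        Matrix.one_apply]
      by_cases hpq : p = q
      · subst hpq
        simp
      · rw [diagonal_apply_ne _ ((e i).symm.injective.ne hpq)]
        rw [Prod.ext_iff, not_and_or] at hpq
        rcases hpq with h | h <;> simp [h]
    have h2 : locHom n i (U i * P i * (U i)ᴴ) =
        diagonal fun x : ∀ i, n i => if ((e i (x i)).1 : ℕ) = 0 then (1 : ℂ) else 0 := by
      rw [h1]
      ext x y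
      rw [show ∀ X, locHom n i X x y = loc i X x y from fun _ => rfl, loc_apply, diagonal_apply,
        diagonal_apply]
      by_cases hxy : x = y
      · subst hxy
        simp
      · rw [if_neg hxy]
        by_cases h3 : y = Function.update x i (y i)
        · have h4 : x i ≠ y i := by
            intro h4
            rw [← h4, Function.update_eq_self] at h3
            exact hxy h3.symm
          rw [if_pos h3, if_neg h4]
        · rw [if_neg h3]
    rw [h2, diagonal_mul, ite_mul, one_mul, zero_mul]
  have hent : ∀ i (p q : Fin d × Fin (D i)),
      (U i * S i * (U i)ᴴ) ((e i).symm p) ((e i).symm q) =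
        lowerPhase d (-τ i) p.1 q.1 * (1 : Matrix (Fin (D i)) (Fin (D i)) ℂ) p.2 q.2 := by
    intro i p q
    have h1 := congrFun (congrFun (hform i 0) p) q
    rw [twist_zero, Matrix.mul_one, zero_sub] at h1
    exact h1
  set f := splitEquiv e with hf
  set r : (Fin N → Fin d) → (∀ i, Fin (D i)) → (Fin N → Fin d) → (∀ i, Fin (D i)) → ℂ :=
    fun a s b t => ρ' (f.symm (a, s)) (f.symm (b, t)) with hr
  have hd0 : 0 < d := by omega
  have hghz := eq_ghzState_mul hN0 (fun i => -τ i) (by rw [Finset.sum_neg_distrib, hτ, neg_zero]) r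
    (by
      intro a s b t
      exact (hpsd.1.apply _ _).symm)
    (by
      intro a s b t i hne
      have h1 := congrFun (congrFun (hP' i) (f.symm (a, s))) (f.symm (b, t))
      rw [hProw, hProw] at h1
      simp only [hf, splitEquiv, Equiv.coe_fn_symm_mk, Equiv.apply_symm_apply] at h1
      change (if (a i : ℕ) = 0 then r a s b t else 0) =
        if (a ⟨0, hN0⟩ : ℕ) = 0 then r a s b t else 0 at h1
      split_ifs at h1 <;> simp_all)
    (by
      intro a a' ha s b t
      have h1 := congrFun (congrFun hS' (f.symm (a, s))) (f.symm (b, t))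
      rw [Matrix.mul_apply, Finset.sum_eq_single (f.symm (a', s))] at h1
      · rw [hr]
        simp only
        rw [← h1, tensor_apply]
        congr 1
        refine Finset.prod_congr rfl fun i _ => ?_
        refine (hent i (a i, s i) (a' i, s i)).trans ?_
        rw [lowerPhase_apply, if_pos (ha i), Matrix.one_apply_eq, mul_one]
      · intro z _ hz
        obtain ⟨i, hi⟩ : ∃ i, e i (z i) ≠ (a' i, s i) := by
          by_contra! h
          apply hz
          ext1 i
          exact (e i).injective ((h i).trans ((e i).apply_symm_apply _).symm)
        rw [tensor_apply, Finset.prod_eq_zero (Finset.mem_univ i), zero_mul]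
        have h2 := hent i (a i, s i) (e i (z i))
        rw [Equiv.symm_apply_apply] at h2
        refine h2.trans ?_
        rw [lowerPhase_apply, Matrix.one_apply]
        simp only
        by_cases h3 : s i = (e i (z i)).2
        · rw [if_neg, zero_mul]
          intro h4
          exact hi (Prod.ext (Fin.ext (h4.trans (ha i).symm)) h3.symm)
        · rw [if_neg h3, mul_zero]
      · simp)
    ⟨0, hd0⟩ rfl
  -- The block of ρ' with all ideal indices 0; the factor d compensates the GHZ entry 1/d.
  set σ : Matrix (∀ i, Fin (D i)) (∀ i, Fin (D i)) ℂ :=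
    (d : ℂ) • ρ'.submatrix (fun s => f.symm (fun _ => ⟨0, hd0⟩, s))
      (fun s => f.symm (fun _ => ⟨0, hd0⟩, s)) with hσ
  have hsplit : ∀ x y : ∀ i, n i, ρ' x y =
      ghzState N d (fun i => (e i (x i)).1) (fun i => (e i (y i)).1) *
          σ (fun i => (e i (x i)).2) (fun i => (e i (y i)).2) := by
    intro x y
    have h1 := hghz (f x).1 (f x).2 (f y).1 (f y).2
    simp only [hr, Prod.mk.eta, Equiv.symm_apply_apply] at h1
    exact h1
  refine ⟨D, e, U, σ, hU, ⟨?_, ?_⟩, hsplit, hform⟩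
  · exact (hpsd.submatrix _).smul (by exact_mod_cast hd0.le)
  · have h1 : ρ'.trace = (ghzState N d).trace * σ.trace := by
      rw [Matrix.trace, Matrix.trace, Matrix.trace, Finset.sum_mul_sum, ← Fintype.sum_prod_type',
        ← f.sum_comp]
      refine Finset.sum_congr rfl fun x _ => ?_
      exact hsplit x x
    rwa [htr, trace_ghzState hN0 (by omega), one_mul, eq_comm] at h1

end Rigidity

end ASTA

namespace ASTA
open Matrix

set_option linter.unusedSectionVars false

/-! ### The ideal realisation attains the bound. -/

section IdealRealisation

/-- On nonzero entries b - a ≡ 1 mod d, so an integer phase is a scalar. This matches A_{x+m} = ωA_x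
and lets `idealPos` stay linear beyond m. -/
lemma lowerPhase_add_intCast {d : ℕ} (r : ℝ) (k : ℤ) :
    lowerPhase d (r + k) = omegaPow d k • lowerPhase d r := by
  ext a b
  rw [Matrix.smul_apply, lowerPhase_apply, lowerPhase_apply, smul_eq_mul]
  have hd : d ≠ 0 := a.pos.ne'
  split_ifs with h
  · have h1 : omegaPow d (((b : ℝ) - a) * k - k) = 1 := by
      have h2 : (d : ℤ) ∣ (((b : ℕ) : ℤ) - ((a : ℕ) : ℤ)) * k - k := by
        have h3 := ((dvd_succ_sub_iff a b).2 h).mul_right (-k)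
        rwa [show (((a : ℕ) : ℤ) + 1 - ((b : ℕ) : ℤ)) * -k =
          (((b : ℕ) : ℤ) - ((a : ℕ) : ℤ)) * k - k by ring] at h3
      have := (omegaPow_intCast_eq_one_iff hd _).2 h2
      push_cast at this
      exact this
    rw [← omegaPow_add, show ((b : ℝ) - a) * (r + k) =
      (((b : ℝ) - a) * k - k) + (k + ((b : ℝ) - a) * r) by ring, omegaPow_add, h1, one_mul]
  · simp

lemma lowerPhase_mul_conjTranspose (d : ℕ) (r : ℝ) : lowerPhase d r * (lowerPhase d r)ᴴ = 1 := by
  ext a b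
  have hd : 0 < d := a.pos
  rw [Matrix.mul_apply, Finset.sum_eq_single ⟨((a : ℕ) + 1) % d, Nat.mod_lt _ hd⟩]
  · rw [conjTranspose_apply, lowerPhase_apply, if_pos rfl, lowerPhase_apply, Matrix.one_apply]
    by_cases h : a = b
    · subst h
      rw [if_pos rfl, if_pos rfl, star_omegaPow, omegaPow_mul_neg]
    · rw [if_neg h, if_neg]
      · simp
      · intro h1
        have h2 : (a : ℕ) ≡ b [MOD d] := Nat.ModEq.add_right_cancel' 1 h1
        exact h (Fin.ext (h2.eq_of_lt_of_lt a.isLt b.isLt))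
  · intro c _ hc
    rw [lowerPhase_apply, if_neg fun h => hc (Fin.ext h), zero_mul]
  · simp

lemma isObservable_lowerPhase (d : ℕ) (r : ℝ) : IsObservable d (lowerPhase d r) := by
  refine ⟨Matrix.mem_unitaryGroup_iff.2 (lowerPhase_mul_conjTranspose d r), ?_⟩
  ext a b
  rw [lowerPhase_pow_apply, Nat.add_mod_right, Nat.mod_eq_of_lt a.isLt, Matrix.one_apply]
  by_cases h : a = b
  · simp [h, omegaPow_zero]
  · rw [if_neg h, if_neg fun h' => h (Fin.ext h'.symm)]

lemma isObservable_idealObs {m d : ℕ} (hd : d ≠ 0) (i x : ℕ) :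
    IsObservable d (idealObs m d i x) := by
  rw [idealObs_eq hd]
  split_ifs
  · exact isObservable_lowerPhase d _
  · exact (isObservable_lowerPhase d _).star
  · exact isObservable_lowerPhase d _
  · exact (isObservable_lowerPhase d _).star

/-- The position of the factor of party `i` with setting `q` on the orbit `r ↦ lowerPhase d r`. -/
noncomputable def idealPos (m i q : ℕ) : ℝ :=
  if i = 0 then (q + 1) / m - 1 / (2 * m) else if i = 1 then -((q + 1) / m)
  else if Even i then q / m else -(q / m)

lemma extObs_idealObs {m d : ℕ} (hd : d ≠ 0) (hm : 0 < m) (i q : ℕ) :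
    extObs d (fun x : Fin m => idealObs m d i x) q =
      if Even i then lowerPhase d (idealPos m i q) else (lowerPhase d (idealPos m i q))ᴴ := by
  have hq : (q : ℝ) = m * (q / m : ℕ) + (q % m : ℕ) := by exact_mod_cast (Nat.div_add_mod q m).symm
  rw [extObs, dif_pos hm, idealObs_eq hd, idealPos]
  have key : ∀ r s : ℝ, s = r + (q / m : ℕ) →
      omegaPow d (q / m : ℕ) • lowerPhase d r = lowerPhase d s := by
    intro r s h
    have := lowerPhase_add_intCast (d := d) r ((q / m : ℕ) : ℤ)
    rw [Int.cast_natCast] at this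
    rw [h, this]
  have key' : ∀ r s : ℝ, s = r - (q / m : ℕ) →
      omegaPow d (q / m : ℕ) • (lowerPhase d r)ᴴ = (lowerPhase d s)ᴴ := by
    intro r s h
    have := lowerPhase_add_intCast (d := d) r (-((q / m : ℕ) : ℤ))
    rw [Int.cast_neg, Int.cast_natCast, ← sub_eq_add_neg] at this
    rw [h, this, conjTranspose_smul, star_omegaPow, neg_neg]
  by_cases h0 : i = 0
  · subst h0
    simp only [if_true, Even.zero]
    apply key
    rw [hq]
    field_simp
    ring
  by_cases h1 : i = 1
  · subst h1
    simp only [if_neg one_ne_zero, if_true, if_neg Nat.not_even_one]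
    apply key'
    rw [hq]
    field_simp
    ring
  simp only [if_neg h0, if_neg h1]
  split_ifs
  · apply key
    rw [hq]
    field_simp
    ring
  · apply key'
    rw [hq]
    field_simp
    ring

/-- The weights interpolate two neighbouring observables at the midpoint of their phases: entries
that do not wrap have b - a = k, those that wrap have k - d. -/
lemma firstFactor_idealObs {m d : ℕ} (hd : d ≠ 0) (hm : 2 ≤ m) {k : ℕ} (hk : k < d) (q : ℕ) :
    firstFactor d (fun x : Fin m => idealObs m d 0 x) k q = lowerPhase d ((q + 1) / m) ^ k := by
  rw [firstFactor, extObs_idealObs hd (by omega), extObs_idealObs hd (by omega),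
    if_pos Even.zero, if_pos Even.zero]
  set r := idealPos m 0 q with hr
  have hr1 : idealPos m 0 (q + 1) = r + 1 / m := by
    rw [hr]
    simp only [idealPos, if_true]
    push_cast
    ring
  have hr2 : ((q : ℝ) + 1) / m = r + 1 / (2 * m) := by
    rw [hr]
    simp only [idealPos, if_true]
    ring
  rw [hr1, hr2]
  ext a b
  simp only [Matrix.add_apply, Matrix.smul_apply, lowerPhase_pow_apply, smul_eq_mul]
  by_cases h : (b : ℕ) = (a + k) % d
  · rw [if_pos h, if_pos h, if_pos h]
    rcases Nat.lt_or_ge ((a : ℕ) + k) d with h1 | h1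
    · rw [Nat.mod_eq_of_lt h1] at h
      have h2 : (b : ℝ) - a = k := by
        rw [h]
        push_cast
        ring
      rw [h2, aCoeff_mul_add_low hd hm]
    · have h2 : (b : ℝ) - a = k - d := by
        rw [Nat.mod_eq_sub_mod h1, Nat.mod_eq_of_lt (by have := a.isLt; omega)] at h
        rw [h, Nat.cast_sub h1]
        push_cast
        ring
      rw [h2, sub_mul, sub_mul, sub_mul, aCoeff_mul_add_high hd hm]
  · rw [if_neg h, if_neg h, if_neg h]
    simp

/-- A product of phased shifts whose phases add up to zero stabilises the GHZ state. -/
lemma tensor_lowerPhase_mul_ghzState {N d : ℕ} (hN : 0 < N) (r : Fin N → ℝ) (hr : ∑ i, r i = 0)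
    (k : ℕ) : tensor (fun i => lowerPhase d (r i) ^ k) * ghzState N d = ghzState N d := by
  rw [ghzState, Matrix.mul_vecMulVec]
  congr 1
  ext x
  have hd : 0 < d := (x ⟨0, hN⟩).pos
  have h1 : (tensor (fun i => lowerPhase d (r i) ^ k) *ᵥ ghz N d) x =
      ((1 / Real.sqrt d : ℝ) : ℂ) * ∑ j : Fin d, ∏ i, (lowerPhase d (r i) ^ k) (x i) j := by
    rw [mulVec, dotProduct]
    simp only [ghz, Finset.mul_sum]
    rw [Finset.sum_comm]
    refine Finset.sum_congr rfl fun j _ => ?_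
    rw [Finset.sum_eq_single fun _ => j]
    · rw [tensor_apply]
      simp [mul_comm]
    · intro y _ hy
      obtain ⟨i, hi⟩ := Function.ne_iff.1 hy
      rw [Finset.prod_eq_zero (Finset.mem_univ i) (if_neg hi)]
      simp
    · simp
  rw [h1, ghz_apply hN x _ rfl]
  split_ifs with hx
  · rw [Finset.sum_eq_single ⟨((x ⟨0, hN⟩ : ℕ) + k) % d, Nat.mod_lt _ hd⟩]
    · simp only [hx, lowerPhase_pow_apply, if_true]
      rw [← omegaPow_sum, ← Finset.mul_sum, hr, mul_zero, omegaPow_zero, mul_one]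
    · intro j _ hj
      apply Finset.prod_eq_zero (Finset.mem_univ ⟨0, hN⟩)
      rw [lowerPhase_pow_apply, if_neg fun h => hj (Fin.ext h)]
    · simp
  · push Not at hx
    obtain ⟨i, hi⟩ := hx
    rw [Finset.sum_eq_zero, mul_zero]
    intro j _
    by_cases h : (j : ℕ) = (x i + k) % d
    · apply Finset.prod_eq_zero (Finset.mem_univ ⟨0, hN⟩)
      rw [lowerPhase_pow_apply, if_neg]
      intro h'
      have h2 : (x i : ℕ) ≡ x ⟨0, hN⟩ [MOD d] := Nat.ModEq.add_right_cancel' k (h.symm.trans h')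
      exact hi (Fin.ext (h2.eq_of_lt_of_lt (Fin.isLt _) (Fin.isLt _)))
    · apply Finset.prod_eq_zero (Finset.mem_univ i)
      rw [lowerPhase_pow_apply, if_neg h]

lemma tensor_bellFactor_idealObs_mul {N m d : ℕ} (hN : 2 ≤ N) (hd : d ≠ 0) (hm : 2 ≤ m)
    (α : Fin (N - 1) → Fin m) {k : ℕ} (hk : k < d) :
    tensor (bellFactor d (fun (i : Fin N) (x : Fin m) => idealObs m d i x) α k) * ghzState N d =
      ghzState N d := by
  -- A primitive of the phases of the parties: they telescope to g(N) - g(0) = 0, using α_N = 1,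
  -- which is the default value 0 of `settingIndex`.
  set g : ℕ → ℝ := fun i => if i = 0 then 0 else
    (-1) ^ (i - 1) * ((settingIndex α (i - 1) + if i = 1 then 1 else 0) / m) with hg
  have hfac : ∀ i : Fin N, bellFactor d (fun (i : Fin N) (x : Fin m) => idealObs m d i x) α k i =
      lowerPhase d (g (i + 1) - g i) ^ k := by
    intro i
    by_cases h0 : (i : ℕ) = 0
    · rw [bellFactor_zero i h0, h0, firstFactor_idealObs hd hm hk]
      simp [hg]
    have hpos : idealPos m i (settingIndex α (i - 1) + settingIndex α i) = g (i + 1) - g i := by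
      obtain ⟨j, hj⟩ : ∃ j, (i : ℕ) = j + 1 := ⟨i - 1, by omega⟩
      rw [hj]
      simp only [idealPos, hg, Nat.add_sub_cancel, if_neg (Nat.succ_ne_zero _)]
      by_cases hj0 : j = 0
      · subst hj0
        simp
        ring
      · have hj1 : j + 1 ≠ 1 := by omega
        have hj2 : j + 1 + 1 ≠ 1 := by omega
        rw [if_neg hj1, if_neg hj1, if_neg hj2]
        split_ifs with he
        · rw [he.neg_one_pow]
          have : Odd j := by
            rw [← Nat.not_even_iff_odd]
            exact Nat.even_add_one.1 he
          rw [this.neg_one_pow]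
          push_cast
          ring
        · rw [(Nat.not_even_iff_odd.1 he).neg_one_pow]
          have : Even j := by
            by_contra h
            exact he (Nat.even_add_one.2 h)
          rw [this.neg_one_pow]
          push_cast
          ring
    rw [bellFactor, if_neg h0, extObs_idealObs hd (by omega), hpos]
    split_ifs
    · rfl
    · rw [conjTranspose_conjTranspose]
  rw [funext hfac]
  apply tensor_lowerPhase_mul_ghzState (by omega)
  rw [Fin.sum_univ_eq_sum_range (fun i => g (i + 1) - g i), Finset.sum_range_sub]
  have h1 : settingIndex α (N - 1) = 0 := by rw [settingIndex, dif_neg (lt_irrefl _)]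
  simp only [hg, if_true, if_neg (by omega : N ≠ 0), if_neg (by omega : N ≠ 1), h1]
  simp

lemma bellValue_ideal {N m d : ℕ} (hN : 2 ≤ N) (hd : 2 ≤ d) (hm : 2 ≤ m) :
    bellValue d (fun (i : Fin N) (x : Fin m) => idealObs m d i x) (ghzState N d) =
      (m : ℝ) ^ (N - 1) * (d - 1) := by
  rw [bellValue, bellOperator, Matrix.sum_mul, Matrix.trace_sum, Complex.re_sum]
  have h1 : ∀ α : Fin (N - 1) → Fin m, ((∑ k ∈ Finset.Icc 1 (d - 1), tensor (bellFactor d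
      (fun (i : Fin N) (x : Fin m) => idealObs m d i x) α k)) * ghzState N d).trace.re =
      (d : ℝ) - 1 := by
    intro α
    rw [Matrix.sum_mul, Finset.sum_congr rfl fun k hk => tensor_bellFactor_idealObs_mul hN
      (by omega) hm α (by have := Finset.mem_Icc.1 hk; omega : k < d), Matrix.trace_sum,
      trace_ghzState (by omega) (by omega)]
    simp only [Finset.sum_const, Nat.card_Icc, Nat.add_sub_cancel, nsmul_eq_mul, mul_one,
      Complex.natCast_re]
    rw [Nat.cast_sub (by omega : 1 ≤ d), Nat.cast_one]
  rw [Finset.sum_congr rfl fun α _ => h1 α, Finset.sum_const, Finset.card_univ, Fintype.card_fun,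
    Fintype.card_fin, Fintype.card_fin, nsmul_eq_mul, Nat.cast_pow]

theorem isGreatest_quantumValues {N m d : ℕ} (hN : 2 ≤ N) (hm : 2 ≤ m) (hd : 2 ≤ d) :
    IsGreatest (quantumValues N m d) ((m : ℝ) ^ (N - 1) * ((d : ℝ) - 1)) := by
  refine ⟨⟨fun _ => d, fun i x => idealObs m d i x, ghzState N d,
    isState_ghzState (by omega) (by omega), fun i x => isObservable_idealObs (by omega) i x,
    bellValue_ideal hN hd hm⟩, ?_⟩
  rintro v ⟨D, A, ρ, hρ, hA, rfl⟩
  exact bellValue_le hρ hN hd hm hA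

end IdealRealisation

end ASTA

theorem theorem3p1 (N m d : ℕ) (hN : 2 ≤ N) (hm : 2 ≤ m) (hd : 2 ≤ d) :
    -- `m ^ (N - 1) * (d - 1)` is the maximal quantum value of the Bell expression
    IsGreatest (ASTA.quantumValues N m d) ((m : ℝ) ^ (N - 1) * ((d : ℝ) - 1)) ∧
    -- and every realisation that reaches it is the ideal one up to local unitaries
    ∀ (n : Fin N → Type*) [∀ i, Fintype (n i)] [∀ i, DecidableEq (n i)]
      (A : ∀ i, Fin m → Matrix (n i) (n i) ℂ) (ρ : Matrix (∀ i, n i) (∀ i, n i) ℂ),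
      ASTA.IsState ρ →
      (∀ i, (ASTA.reducedState ρ i).rank = Fintype.card (n i)) →
      (∀ i x, ASTA.IsObservable d (A i x)) →
      ASTA.bellValue d A ρ = (m : ℝ) ^ (N - 1) * ((d : ℝ) - 1) →
      -- identifications of `ℂ^(n i)` with `ℂ^d ⊗ ℂ^(D i)`
      ∃ (D : Fin N → ℕ) (e : ∀ i, n i ≃ Fin d × Fin (D i))
        -- local unitaries
        (U : ∀ i, Matrix (n i) (n i) ℂ)
        -- the auxiliary state
        (σ : Matrix (∀ i, Fin (D i)) (∀ i, Fin (D i)) ℂ),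
        (∀ i, U i ∈ Matrix.unitaryGroup (n i) ℂ) ∧
        ASTA.IsState σ ∧
        (∀ x y : ∀ i, n i,
          (ASTA.tensor U * ρ * (ASTA.tensor U).conjTranspose) x y =
            ASTA.ghzState N d (fun i => (e i (x i)).1) (fun i => (e i (y i)).1) *
              σ (fun i => (e i (x i)).2) (fun i => (e i (y i)).2)) ∧
        (∀ (i : Fin N) (x : Fin m),
          Matrix.reindex (e i) (e i) (U i * A i x * (U i).conjTranspose) =
            ASTA.idealObs m d i x ⊗ₖ (1 : Matrix (Fin (D i)) (Fin (D i)) ℂ)) := by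
  refine ⟨ASTA.isGreatest_quantumValues hN hm hd, ?_⟩
  intro n _ _ A ρ hρ hrank hA hmax
  have hd' : d ≠ 0 := by omega
  set i₀ : Fin N := ⟨0, by omega⟩ with hi₀
  set i₁ : Fin N := ⟨1, by omega⟩ with hi₁
  obtain ⟨hSρ, P, hP⟩ := ASTA.exists_shift_of_max hρ hN hd hm hA hmax hrank (i₀ := i₀) rfl
  obtain ⟨D, e, U, σ, hU, hσ, hghz, hobs⟩ := ASTA.exists_unitary_of_shifts hN hd hρ
    (fun i => (hP i).1) hSρ (i₀ := i₀) rfl (fun i => (hP i).2.1)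
    -- The normal form has base phase 0 at setting 0 for every later party and 1/m too little for
    -- the first one; the ideal phases of parties 0 and 1 are offset by 1/m and -1/m, and these
    -- offsets cancel in the sum.
    (fun i => (if i = i₀ then -(1 / (m : ℝ)) else 0) + if i = i₁ then 1 / (m : ℝ) else 0)
    (by simp [Finset.sum_add_distrib])
  refine ⟨D, e, U, σ, hU, hσ, hghz, fun i x => ?_⟩
  have hx := (hP i).2.2 x
  have hstar : ∀ {r : ℝ}, star (A i x) = ASTA.partyFactor d A i 0 * ASTA.twist d r (P i) →
      Matrix.reindex (e i) (e i) (U i * A i x * (U i).conjTranspose) =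
        (ASTA.lowerPhase d (r - ((if i = i₀ then -(1 / (m : ℝ)) else 0) +
          if i = i₁ then 1 / (m : ℝ) else 0))).conjTranspose ⊗ₖ
          (1 : Matrix (Fin (D i)) (Fin (D i)) ℂ) := by
    intro r h
    have h1 := congrArg Matrix.conjTranspose (hobs i r)
    rw [← h, Matrix.conjTranspose_reindex, Matrix.conjTranspose_mul, Matrix.conjTranspose_mul,
      Matrix.conjTranspose_conjTranspose, ← Matrix.star_eq_conjTranspose (star (A i x)), star_star,
      Matrix.conjTranspose_kronecker, Matrix.conjTranspose_one, ← Matrix.mul_assoc] at h1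
    exact h1
  have e₀ : i = i₀ ↔ (i : ℕ) = 0 := by simp [hi₀, Fin.ext_iff]
  have e₁ : i = i₁ ↔ (i : ℕ) = 1 := by simp [hi₁, Fin.ext_iff]
  rw [ASTA.idealObs_eq hd']
  simp only [e₀, e₁] at hobs hstar
  by_cases h0 : (i : ℕ) = 0
  · have h1 : (i : ℕ) ≠ 1 := by omega
    rw [if_pos h0, if_pos h0] at hx
    rw [if_pos h0, hx, hobs, if_pos (e₀.2 h0), if_neg (fun h => h1 (e₁.1 h))]
    congr 2
    field_simp
    ring
  · by_cases h1 : (i : ℕ) = 1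
    · rw [if_neg h0, if_neg h0, if_neg (by rw [h1]; decide), if_neg (by rw [h1]; decide)] at hx
      rw [hstar hx, if_neg h0, if_neg h0, if_pos h1, if_pos h1]
      congr 3
      ring
    · by_cases he : Even (i : ℕ)
      · rw [if_neg h0, if_neg h0, if_pos he, if_pos he] at hx
        rw [if_neg h0, if_neg h1, if_pos he, hx, hobs, if_neg (fun h => h0 (e₀.1 h)),
          if_neg (fun h => h1 (e₁.1 h))]
        congr 2
        ring
      · rw [if_neg h0, if_neg h0, if_neg he, if_neg he] at hx
        rw [hstar hx, if_neg h0, if_neg h1, if_neg he, if_neg h0, if_neg h1]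
        congr 3
        ring
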